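/- Let $K$ be an infinite field, $\Gamma$ a finite acyclic quiver (no oriented cycles of positive length), $I$ an admissible ideal of the path algebra $K\Gamma$ (a two-sided ideal with $\mathfrak a^m\subseteq I\subseteq \mathfrak a^2$ for some $m$, where $\mathfrak a$ is the ideal generated by the arrows; products of paths are written so that $qp$ means "$q$ after $p$"), and $\Lambda=K\Gamma/I$, with Jacobson radical $J$. All modules are finitely generated left $\Lambda$-modules. A module is *uniserial* if it is nonzero and its submodules form a chain; $\operatorname{top}U=U/JU$, and $\operatorname{soc}U$ is the sum of the simple submodules of $U$. A path $p$ of length $l\ge 0$ in $\Gamma$ is a *mast* if there is a uniserial $\Lambda$-module $U$ of composition length $l+1$ with $pU\ne 0$. Then the following are equivalent: 1. $\Lambda$ has finite uniserial type, i.e. there are only finitely many isomorphism classes of uniserial left $\Lambda$-modules. 2. $\Lambda$ satisfies condition (N): whenever $\alpha:e\to e'$ is an arrow of $\Gamma$ and $p:e\to e'$ is a mast of positive length, $p$ is of the form $p=c'\alpha$ with $c'$ an oriented cycle at $e'$, or $p=\alpha c$ with $c$ an oriented cycle at $e$ (where $c$, $c'$ may be trivial). 3. Whenever $S$ and $S'$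 are simple left $\Lambda$-modules with $\operatorname{Ext}^1_\Lambda(S,S')\neq 0$, there exists, up to isomorphism, precisely one uniserial left $\Lambda$-module $U$ with $\operatorname{soc}U\cong S'$ and $\operatorname{top}U\cong S$. Moreover, if (3) holds, then for all simple left $\Lambda$-modules $S,S'$ with $\operatorname{Ext}^1_\Lambda(S,S')\ne0$ there are no uniserial left $\Lambda$-modules of length $>2$ with socle $S'$ and top $S$. -/

import Mathlib

universe u v w

noncomputable section

/-! ### The path algebra of a finite quiver -/

/-- The paths (including the trivial path at each vertex) of a quiver, with arbitrary end points. -/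
abbrev TotalPath (V : Type u) [Quiver.{v} V] : Type (max u v) :=
  Σ a b : V, Quiver.Path a b

/-- The path algebra `K Γ`: the vector space with basis the paths of the quiver. -/
def PathAlgebra (K : Type w) (V : Type u) [Quiver.{v} V] [Field K] : Type (max u v w) :=
  TotalPath V →₀ K

namespace PathAlgebra

variable (K : Type w) {V : Type u} [Quiver.{v} V] [Field K]

instance : AddCommGroup (PathAlgebra K V) :=
  inferInstanceAs (AddCommGroup (TotalPath V →₀ K))

instance : Module K (PathAlgebra K V) :=
  inferInstanceAs (Module K (TotalPath V →₀ K))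

/-- A path, considered as an element of the path algebra. -/
def ofPath {a b : V} (p : Quiver.Path a b) : PathAlgebra K V :=
  Finsupp.single (⟨a, b, p⟩ : TotalPath V) 1

open Classical in
/-- The product of two paths: `q p` is "`q` after `p`" if `p` ends where `q` starts,
and `0` otherwise. -/
def mulPath (q p : TotalPath V) : PathAlgebra K V :=
  if h : q.1 = p.2.1 then ofPath K (p.2.2.comp (q.2.2.cast h rfl)) else 0

/-- The bilinear extension of the product of paths. -/
def mulHom : PathAlgebra K V →ₗ[K] PathAlgebra K V →ₗ[K] PathAlgebra K V :=
  Finsupp.lift (PathAlgebra K V →ₗ[K] PathAlgebra K V) K (TotalPath V) fun q =>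
    Finsupp.lift (PathAlgebra K V) K (TotalPath V) fun p => mulPath K q p

instance : Mul (PathAlgebra K V) := ⟨fun x y => mulHom K x y⟩

/-- The identity is the sum of the trivial paths. -/
instance [Fintype V] : One (PathAlgebra K V) :=
  ⟨∑ a : V, ofPath K (Quiver.Path.nil : Quiver.Path a a)⟩

variable {K}

theorem mul_def (x y : PathAlgebra K V) : x * y = mulHom K x y := rfl

theorem one_def [Fintype V] :
    (1 : PathAlgebra K V) = ∑ a : V, ofPath K (Quiver.Path.nil : Quiver.Path a a) := rfl

theorem mulHom_ofPath {a b c d : V} (q : Quiver.Path c d) (p : Quiver.Path a b) :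
    mulHom K (ofPath K q) (ofPath K p) = mulPath K ⟨c, d, q⟩ ⟨a, b, p⟩ := by
  have h (X : Type _) [AddCommGroup X] [Module K X] (f : TotalPath V → X) (t : TotalPath V) :
      Finsupp.lift X K (TotalPath V) f (Finsupp.single t 1) = f t := by
    simp
  unfold mulHom ofPath
  erw [h, h]

theorem ofPath_mul_ofPath {a b c : V} (q : Quiver.Path b c) (p : Quiver.Path a b) :
    ofPath K q * ofPath K p = ofPath K (p.comp q) := by
  rw [mul_def, mulHom_ofPath]
  simp [mulPath]

theorem ofPath_mul_ofPath_of_ne {a b c d : V} (q : Quiver.Path c d) (p : Quiver.Path a b)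
    (h : c ≠ b) : ofPath K q * ofPath K p = 0 := by
  rw [mul_def, mulHom_ofPath]
  simp [mulPath, h]

@[elab_as_elim]
theorem induction {P : PathAlgebra K V → Prop} (x : PathAlgebra K V) (zero : P 0)
    (add : ∀ x y, P x → P y → P (x + y))
    (smul : ∀ (k : K) {a b : V} (p : Quiver.Path a b), P (k • ofPath K p)) : P x := by
  refine Finsupp.induction_linear x zero add ?_
  rintro ⟨a, b, p⟩ k
  have h := smul k p
  have e : k • ofPath K p = (Finsupp.single (⟨a, b, p⟩ : TotalPath V) k : TotalPath V →₀ K) := by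
    change k • (Finsupp.single (⟨a, b, p⟩ : TotalPath V) (1 : K)) = _
    simp
  rw [e] at h
  exact h

theorem add_mul' (x y z : PathAlgebra K V) : (x + y) * z = x * z + y * z := by
  simp [mul_def]

theorem mul_add' (x y z : PathAlgebra K V) : x * (y + z) = x * y + x * z := by
  simp [mul_def]

theorem smul_mul' (k : K) (x y : PathAlgebra K V) : (k • x) * y = k • (x * y) := by
  simp [mul_def]

theorem mul_smul' (k : K) (x y : PathAlgebra K V) : x * (k • y) = k • (x * y) := by
  simp [mul_def]

theorem zero_mul' (x : PathAlgebra K V) : 0 * x = 0 := by simp [mul_def]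

theorem mul_zero' (x : PathAlgebra K V) : x * 0 = 0 := by simp [mul_def]

theorem mul_assoc' (x y z : PathAlgebra K V) : x * y * z = x * (y * z) := by
  induction x using PathAlgebra.induction with
  | zero => simp only [zero_mul']
  | add x x' hx hx' => simp only [add_mul', hx, hx']
  | @smul k c d r =>
    induction y using PathAlgebra.induction with
    | zero => simp only [zero_mul', mul_zero']
    | add y y' hy hy' => simp only [add_mul', mul_add', hy, hy']
    | @smul l a b q =>
      induction z using PathAlgebra.induction with
      | zero => simp only [mul_zero']
      | add z z' hz hz' => simp only [mul_add', hz, hz']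
      | @smul m e f p =>
        simp only [smul_mul', mul_smul']
        congr 3
        by_cases h : c = b
        · subst h
          by_cases h' : a = f
          · subst h'
            simp only [ofPath_mul_ofPath, Quiver.Path.comp_assoc]
          · simp only [ofPath_mul_ofPath, ofPath_mul_ofPath_of_ne _ _ h', mul_zero']
        · by_cases h' : a = f
          · subst h'
            simp only [ofPath_mul_ofPath, ofPath_mul_ofPath_of_ne _ _ h, zero_mul']
          · simp only [ofPath_mul_ofPath_of_ne _ _ h, ofPath_mul_ofPath_of_ne _ _ h', zero_mul',
              mul_zero']

variable [Fintype V]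

theorem one_mul' (x : PathAlgebra K V) : 1 * x = x := by
  induction x using PathAlgebra.induction with
  | zero => rw [mul_zero']
  | add x y hx hy => rw [mul_add', hx, hy]
  | @smul k a b p =>
    rw [mul_smul', one_def, mul_def, map_sum, LinearMap.sum_apply,
      Finset.sum_eq_single_of_mem b (Finset.mem_univ b)]
    · rw [← mul_def, ofPath_mul_ofPath, Quiver.Path.comp_nil]
    · intro c _ hc
      rw [← mul_def, ofPath_mul_ofPath_of_ne _ _ hc]

theorem mul_one' (x : PathAlgebra K V) : x * 1 = x := by
  induction x using PathAlgebra.induction with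
  | zero => rw [zero_mul']
  | add x y hx hy => rw [add_mul', hx, hy]
  | @smul k a b p =>
    rw [smul_mul', one_def, mul_def, map_sum,
      Finset.sum_eq_single_of_mem a (Finset.mem_univ a)]
    · rw [← mul_def, ofPath_mul_ofPath, Quiver.Path.nil_comp]
    · intro c _ hc
      rw [← mul_def, ofPath_mul_ofPath_of_ne _ _ (Ne.symm hc)]

instance : Ring (PathAlgebra K V) where
  __ := (inferInstance : AddCommGroup (PathAlgebra K V))
  __ := (inferInstance : Mul (PathAlgebra K V))
  __ := (inferInstance : One (PathAlgebra K V))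
  left_distrib := mul_add'
  right_distrib := add_mul'
  zero_mul := zero_mul'
  mul_zero := mul_zero'
  mul_assoc := mul_assoc'
  one_mul := one_mul'
  mul_one := mul_one'

instance : Algebra K (PathAlgebra K V) :=
  Algebra.ofModule smul_mul' mul_smul'

variable (K V) in
/-- The `m`-th power of the ideal generated by the arrows, i.e. the linear span of all paths of
length at least `m`. -/
def arrowIdealPow (m : ℕ) : Submodule K (PathAlgebra K V) :=
  Submodule.span K {x | ∃ (a b : V) (p : Quiver.Path a b), m ≤ p.length ∧ x = ofPath K p}

/-- An ideal `I` of the path algebra is admissible if it lies between some power of the arrow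
ideal and its square. -/
def IsAdmissible (I : Ideal (PathAlgebra K V)) : Prop :=
  (∃ m : ℕ, ∀ x ∈ arrowIdealPow K V m, x ∈ I) ∧ ∀ x ∈ I, x ∈ arrowIdealPow K V 2

end PathAlgebra

/-- A quiver is acyclic if it has no oriented cycle of positive length. -/
def IsAcyclicQuiver (V : Type u) [Quiver.{v} V] : Prop :=
  ∀ (a : V) (p : Quiver.Path a a), p.length = 0

/-! ### Uniserial modules -/

section Modules

variable (R : Type u) [Ring R] (M : Type v) [AddCommGroup M] [Module R M]

/-- A uniserial module: a nonzero finitely generated module whose submodules form a chain. -/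
structure IsUniserialModule : Prop where
  finite : Module.Finite R M
  nontrivial : Nontrivial M
  total : ∀ N N' : Submodule R M, N ≤ N' ∨ N' ≤ N

/-- The top `M / J M` of a module, where `J` is the Jacobson radical of the ring. -/
abbrev ModuleTop : Type v := M ⧸ (Ring.jacobson R • ⊤ : Submodule R M)

/-- The socle of a module: the sum of its simple submodules. -/
def moduleSocle : Submodule R M := sSup {N : Submodule R M | IsSimpleModule R N}

/-- `R` has finite uniserial type: up to isomorphism, there are only finitely many uniserial left
`R`-modules. -/
def FiniteUniserialType : Prop :=
  ∃ (n : ℕ) (F : Fin n → ModuleCat.{u} R), ∀ (U : Type u) [AddCommGroup U] [Module R U],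
    IsUniserialModule R U → ∃ i, Nonempty (U ≃ₗ[R] F i)

/-- `Ext¹(S, S') ≠ 0`. -/
def ExtOneNonzero (S S' : Type u) [AddCommGroup S] [Module R S] [AddCommGroup S'] [Module R S'] :
    Prop :=
  Nontrivial (CategoryTheory.Abelian.Ext (ModuleCat.of R S) (ModuleCat.of R S') 1)

/-- `U` is a uniserial module with top `S` and socle `S'`. -/
def IsUniserialWith (U S S' : Type u) [AddCommGroup U] [Module R U] [AddCommGroup S] [Module R S]
    [AddCommGroup S'] [Module R S'] : Prop :=
  IsUniserialModule R U ∧ Nonempty (moduleSocle R U ≃ₗ[R] S') ∧ Nonempty (ModuleTop R U ≃ₗ[R] S)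

/-- Whenever `S`, `S'` are simple with `Ext¹(S, S') ≠ 0`, there is, up to isomorphism, precisely
one uniserial module with top `S` and socle `S'`. -/
def UniqueUniserialOfExt : Prop :=
  ∀ (S S' : Type u) [AddCommGroup S] [Module R S] [AddCommGroup S'] [Module R S'],
    IsSimpleModule R S → IsSimpleModule R S' → ExtOneNonzero R S S' →
      (∃ U : ModuleCat.{u} R, IsUniserialWith R U S S') ∧
      ∀ (U U' : Type u) [AddCommGroup U] [Module R U] [AddCommGroup U'] [Module R U'],
        IsUniserialWith R U S S' → IsUniserialWith R U' S S' → Nonempty (U ≃ₗ[R] U')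

/-- Whenever `S`, `S'` are simple with `Ext¹(S, S') ≠ 0`, there are no uniserial modules of
length greater than `2` with top `S` and socle `S'`. -/
def NoLongUniserialOfExt : Prop :=
  ∀ (S S' : Type u) [AddCommGroup S] [Module R S] [AddCommGroup S'] [Module R S'],
    IsSimpleModule R S → IsSimpleModule R S' → ExtOneNonzero R S S' →
      ∀ (U : Type u) [AddCommGroup U] [Module R U],
        IsUniserialWith R U S S' → ¬ 2 < Module.length R U

end Modules

/-! ### Masts and condition (N) -/

section Masts

variable {K : Type w} {V : Type u} [Quiver.{v} V] [Field K] [Fintype V]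
  (I : Ideal (PathAlgebra K V)) [I.IsTwoSided]

/-- The path `p` of length `l` is a mast of the left module `U` over `K Γ / I` if `U` is uniserial
of length `l + 1` and `p U ≠ 0`. -/
def IsMastOf {a b : V} (p : Quiver.Path a b) (U : Type (max u v w)) [AddCommGroup U]
    [Module (PathAlgebra K V ⧸ I) U] : Prop :=
  IsUniserialModule (PathAlgebra K V ⧸ I) U ∧
    Module.length (PathAlgebra K V ⧸ I) U = p.length + 1 ∧
    ∃ x : U, Ideal.Quotient.mk I (PathAlgebra.ofPath K p) • x ≠ 0

/-- The path `p` is a mast of some uniserial left module over `K Γ / I`. -/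
def IsMast {a b : V} (p : Quiver.Path a b) : Prop :=
  ∃ U : ModuleCat.{max u v w} (PathAlgebra K V ⧸ I), IsMastOf I p U

/-- Condition (N): for every arrow `α` from `a` to `b` and every mast `p` of positive length from
`a` to `b`, `p` is `α` followed by a cycle at `b`, or `α` preceded by a cycle at `a`
(the cycles may be trivial). -/
def ConditionN : Prop :=
  ∀ (a b : V) (α : a ⟶ b) (p : Quiver.Path a b), 0 < p.length → IsMast I p →
    (∃ c : Quiver.Path b b, p = α.toPath.comp c) ∨ (∃ c : Quiver.Path a a, p = c.comp α.toPath)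

end Masts

end

/-! Write `e_c` for the trivial path at `c`. A uniserial module `U` is generated by a single `x =
e_a x`, and since the arrows generate a nilpotent ideal modulo `I` and submodules form a chain, one
path `p` starting at `a` can be followed greedily until `U` is spanned over `K` by the vectors `q
x`, with `q` an initial segment of `p`. Acyclicity makes `p` pass through each vertex at most once,
so every `e_c U` is zero or a line `K (q x)`. This normal form is `HasMast`; the top and socle of
`U` are the simples at the start and end of `p`, and the length is the `K`-dimension. Oriented
cycles being trivial, (N) says that the only mast parallel to an arrow `α` is `α` itself.

If (N) holds, a path that does not kill `x` must be an initial segment of `p`: the first arrow to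
leave `p` and land in `U` nontrivially would be parallel to a different segment of `p`, which is a
mast because it belongs to a subquotient of `U` (`HasMast.exists_comp_eq`). So `p` determines the
annihilator of `x`, hence `U`, and only finitely many paths are nonzero modulo `I`: this gives (1).
Since `Ext¹` between the simples at `a` and `b` is nonzero exactly when there is an arrow from `a`
to `b` (`nonempty_hom_of_extOneNonzero`, `extOneNonzero_of_hom`), every uniserial module in (3) has
an arrow as mast, so it is unique and of length 2. It exists as a nonsplit extension of the two
simples.

If (N) fails, some mast `p ≠ α` is parallel to an arrow `α`. Adding to the action of `α` the map `x
↦ k (p x)` again gives a module over the quotient, because elements of `I` have no `α`-term. If `α x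
= l (p x)` originally, the deformed module has `α x = (l + k) (p x)`, and this scalar is an
isomorphism invariant (`HasMast.exists_family`). The result is a family indexed by `K` with fixed
mast, top and socle, which contradicts both (1) and (3). -/

noncomputable section

open Quiver PathAlgebra

/-! ### Paths -/

/-- Two initial segments of the same path are comparable. -/
theorem Quiver.Path.comparable_of_comp_eq_comp {V : Type u} [Quiver.{v} V] {a b c d : V}
    (q : Path a c) (r : Path c b) (q' : Path a d) (r' : Path d b) (h : q.comp r = q'.comp r') :
    (∃ s : Path c d, q' = q.comp s) ∨ ∃ s : Path d c, q = q'.comp s := by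
  induction r with
  | nil => exact Or.inr ⟨r', h⟩
  | @cons e f r α ih =>
    cases r' with
    | nil => exact Or.inl ⟨r.cons α, h.symm⟩
    | @cons g _ r' β =>
      simp only [Path.comp_cons] at h
      obtain rfl := Path.obj_eq_of_cons_eq_cons h
      exact ih r' (eq_of_heq (Path.heq_of_cons_eq_cons h))

theorem IsAcyclicQuiver.eq_nil {V : Type u} [Quiver.{v} V] (hV : IsAcyclicQuiver V) {a : V}
    (p : Path a a) : p = Path.nil :=
  p.eq_nil_of_length_zero (hV a p)

theorem IsAcyclicQuiver.isEmpty_hom {V : Type u} [Quiver.{v} V] (hV : IsAcyclicQuiver V) {a b : V}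
    (p : Path a b) : IsEmpty (b ⟶ a) :=
  ⟨fun α => by simpa using hV a (p.cons α)⟩

/-- In an acyclic quiver, an initial segment of a path is determined by its end point. -/
theorem IsAcyclicQuiver.initial_unique {V : Type u} [Quiver.{v} V] (hV : IsAcyclicQuiver V)
    {a b c : V} {q q' : Path a c} {r r' : Path c b} (h : q.comp r = q'.comp r') : q = q' := by
  obtain ⟨s, hs⟩ | ⟨s, hs⟩ := Path.comparable_of_comp_eq_comp q r q' r' h
  · rw [hs, hV.eq_nil s, Path.comp_nil]
  · rw [hs, hV.eq_nil s, Path.comp_nil]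

/-- A finite quiver has only finitely many paths of a given length. -/
theorem finite_totalPath_length_eq (V : Type u) [Quiver.{v} V] [Finite V]
    [∀ a b : V, Finite (a ⟶ b)] (n : ℕ) : Finite {t : TotalPath V // t.2.2.length = n} := by
  induction n with
  | zero =>
    refine Finite.of_surjective
      (fun a : V => (⟨⟨a, a, Path.nil⟩, rfl⟩ : {t : TotalPath V // t.2.2.length = 0})) ?_
    rintro ⟨⟨a, b, p⟩, hp⟩
    obtain rfl := Path.eq_of_length_zero p hp
    obtain rfl := Path.eq_nil_of_length_zero p hp
    exact ⟨a, rfl⟩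
  | succ n ih =>
    refine Finite.of_surjective
      (fun x : (Σ (t : {t : TotalPath V // t.2.2.length = n}) (c : V), t.1.2.1 ⟶ c) =>
        (⟨⟨x.1.1.1, x.2.1, x.1.1.2.2.cons x.2.2⟩, by simp [x.1.2]⟩ :
          {t : TotalPath V // t.2.2.length = n + 1})) ?_
    rintro ⟨⟨a, b, p⟩, hp⟩
    cases p with
    | nil => simp at hp
    | @cons c _ p α => exact ⟨⟨⟨⟨a, c, p⟩, by simpa using hp⟩, b, α⟩, rfl⟩

theorem finite_totalPath_length_lt (V : Type u) [Quiver.{v} V] [Finite V]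
    [∀ a b : V, Finite (a ⟶ b)] (m : ℕ) : Finite {t : TotalPath V // t.2.2.length < m} := by
  have := finite_totalPath_length_eq V
  refine Finite.of_surjective
    (fun x : (Σ n : Fin m, {t : TotalPath V // t.2.2.length = (n : ℕ)}) =>
      (⟨x.2.1, by rw [x.2.2]; exact x.1.2⟩ : {t : TotalPath V // t.2.2.length < m})) ?_
  rintro ⟨t, ht⟩
  exact ⟨⟨⟨_, ht⟩, t, rfl⟩, rfl⟩

/-! ### Coefficients -/

namespace PathAlgebra

section Coeff

variable {K : Type w} {V : Type u} [Quiver.{v} V] [Field K]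

variable (K) in
/-- The coefficient of a path in an element of the path algebra. -/
def coeff {a b : V} (p : Path a b) : PathAlgebra K V →ₗ[K] K :=
  Finsupp.lapply (⟨a, b, p⟩ : TotalPath V)

theorem coeff_self {a b : V} (p : Path a b) : coeff K p (ofPath K p) = 1 :=
  Finsupp.single_eq_same

theorem coeff_ne {a b c d : V} (p : Path a b) (q : Path c d)
    (h : (⟨c, d, q⟩ : TotalPath V) ≠ ⟨a, b, p⟩) : coeff K p (ofPath K q) = 0 :=
  Finsupp.single_eq_of_ne h.symm

theorem coeff_of_length_ne {a b c d : V} (p : Path a b) (q : Path c d)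
    (h : q.length ≠ p.length) : coeff K p (ofPath K q) = 0 :=
  coeff_ne p q fun e => h (congrArg (fun t : TotalPath V => t.2.2.length) e)

theorem coeff_of_start_ne {a b c d : V} (p : Path a b) (q : Path c d)
    (h : c ≠ a) : coeff K p (ofPath K q) = 0 :=
  coeff_ne p q fun e => h (congrArg (fun t : TotalPath V => t.1) e)

theorem coeff_of_end_ne {a b c d : V} (p : Path a b) (q : Path c d)
    (h : d ≠ b) : coeff K p (ofPath K q) = 0 :=
  coeff_ne p q fun e => h (congrArg (fun t : TotalPath V => t.2.1) e)

theorem coeff_of_ne {a b : V} {p q : Path a b} (h : q ≠ p) : coeff K p (ofPath K q) = 0 :=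
  coeff_ne p q fun e => h (by simpa using e)

theorem coeff_eq_zero_of_mem [Fintype V] {m : ℕ} {x : PathAlgebra K V} (hx : x ∈ arrowIdealPow K V m)
    {a b : V} (p : Path a b) (hp : p.length < m) : coeff K p x = 0 := by
  have : arrowIdealPow K V m ≤ LinearMap.ker (coeff K p) := by
    refine Submodule.span_le.2 ?_
    rintro _ ⟨c, d, q, hq, rfl⟩
    exact coeff_of_length_ne p q (by omega)
  exact this hx

end Coeff

variable {K : Type w} {V : Type u} [Quiver.{v} V] [Field K] [Fintype V]

/-- An arrow factors only as itself times a trivial path, so its coefficient is a derivation twisted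
by the coefficients at its two ends. This identity is what makes the deformed actions below
multiplicative. -/
theorem coeff_arrow_mul {a b : V} (α : a ⟶ b) (x y : PathAlgebra K V) :
    coeff K α.toPath (x * y) =
      coeff K (Path.nil : Path b b) x * coeff K α.toPath y +
        coeff K α.toPath x * coeff K (Path.nil : Path a a) y := by
  induction x using PathAlgebra.induction with
  | zero => simp
  | add x x' hx hx' => simp only [add_mul, map_add, hx, hx']; ring
  | @smul k c d q =>
    induction y using PathAlgebra.induction with
    | zero => simp
    | add x x' hx hx' => simp only [mul_add, map_add, hx, hx']; ring
    | @smul l e f p =>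
      simp only [smul_mul_smul_comm, map_smul, smul_eq_mul]
      by_cases h : c = f
      · subst h
        rw [ofPath_mul_ofPath]
        cases q with
        | nil =>
          rw [Path.comp_nil, coeff_of_length_ne α.toPath (Path.nil : Path c c) (by simp)]
          by_cases hc : c = b
          · subst hc
            rw [coeff_self]; ring
          · rw [coeff_of_end_ne _ _ hc, coeff_of_end_ne _ _ hc]; ring
        | cons q β =>
          rw [coeff_of_length_ne Path.nil (q.cons β) (by simp)]
          cases p with
          | nil =>
            rw [Path.nil_comp]
            by_cases hc : c = a
            · subst hc
              rw [coeff_self]; ring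
            · rw [coeff_of_start_ne _ _ hc, coeff_of_start_ne _ _ hc]; ring
          | cons p γ =>
            rw [coeff_of_length_ne _ ((p.cons γ).comp (q.cons β)) (by simp),
              coeff_of_length_ne (Path.nil : Path a a) (p.cons γ) (by simp)]; ring
      · rw [ofPath_mul_ofPath_of_ne _ _ h]
        have h1 : coeff K (Path.nil : Path b b) (ofPath K q) * coeff K α.toPath (ofPath K p) = 0 := by
          by_cases hc : c = b
          · rw [coeff_of_end_ne _ p (fun e => h (hc.trans e.symm))]; simp
          · rw [coeff_of_start_ne _ q hc]; simp
        have h2 : coeff K α.toPath (ofPath K q) * coeff K (Path.nil : Path a a) (ofPath K p) = 0 := by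
          by_cases hc : c = a
          · rw [coeff_of_end_ne _ p (fun e => h (hc.trans e.symm))]; simp
          · rw [coeff_of_start_ne _ q hc]; simp
        rw [map_zero]
        linear_combination (-k * l) * h1 + (-k * l) * h2

theorem coeff_arrow_one {a b : V} (α : a ⟶ b) :
    coeff K α.toPath (1 : PathAlgebra K V) = 0 := by
  rw [one_def, map_sum]
  exact Finset.sum_eq_zero fun c _ => coeff_of_length_ne _ _ (by simp)

end PathAlgebra

/-! ### Residue classes of paths -/

section PathClass

variable {K : Type w} {V : Type u} [Quiver.{v} V] [Field K] [Fintype V]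
  (I : Ideal (PathAlgebra K V)) [I.IsTwoSided]

/-- The residue class of a path modulo an ideal of the path algebra. -/
def pathClass {a b : V} (p : Path a b) : PathAlgebra K V ⧸ I :=
  Ideal.Quotient.mk I (ofPath K p)

theorem mk_smul_eq (k : K) (x : PathAlgebra K V) :
    Ideal.Quotient.mk I (k • x) = k • Ideal.Quotient.mk I x := rfl

theorem pathClass_mul {a b c : V} (q : Path b c) (p : Path a b) :
    pathClass I q * pathClass I p = pathClass I (p.comp q) := by
  simp only [pathClass, ← map_mul, ofPath_mul_ofPath]

theorem pathClass_mul_of_ne {a b c d : V} (q : Path c d) (p : Path a b) (h : c ≠ b) :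
    pathClass I q * pathClass I p = 0 := by
  simp only [pathClass, ← map_mul, ofPath_mul_ofPath_of_ne _ _ h, map_zero]

theorem sum_pathClass_nil : ∑ a : V, pathClass I (Path.nil : Path a a) = 1 := by
  simp only [pathClass, ← map_sum, ← one_def, map_one]

theorem pathClass_eq_zero {m : ℕ} (hm : ∀ x ∈ arrowIdealPow K V m, x ∈ I) {a b : V}
    (p : Path a b) (hp : m ≤ p.length) : pathClass I p = 0 :=
  Ideal.Quotient.eq_zero_iff_mem.2 (hm _ (Submodule.subset_span ⟨a, b, p, hp, rfl⟩))

variable {U : Type*} [AddCommGroup U] [Module (PathAlgebra K V ⧸ I) U]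

theorem pathClass_smul_smul {a b c : V} (q : Path b c) (p : Path a b) (x : U) :
    pathClass I q • pathClass I p • x = pathClass I (p.comp q) • x := by
  rw [smul_smul, pathClass_mul]

theorem pathClass_smul_smul_of_ne {a b c d : V} (q : Path c d) (p : Path a b) (h : c ≠ b) (x : U) :
    pathClass I q • pathClass I p • x = 0 := by
  rw [smul_smul, pathClass_mul_of_ne _ _ _ h, zero_smul]

theorem sum_nil_smul (x : U) : ∑ a : V, pathClass I (Path.nil : Path a a) • x = x := by
  rw [← Finset.sum_smul, sum_pathClass_nil, one_smul]

theorem nil_smul_pathClass_smul {a b : V} (p : Path a b) (x : U) :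
    pathClass I (Path.nil : Path b b) • pathClass I p • x = pathClass I p • x := by
  rw [pathClass_smul_smul, Path.comp_nil]

theorem pathClass_smul_nil_smul {a b : V} (p : Path a b) (x : U) :
    pathClass I p • pathClass I (Path.nil : Path a a) • x = pathClass I p • x := by
  rw [pathClass_smul_smul, Path.nil_comp]

theorem pathClass_smul_of_ne {a b c : V} (p : Path a b) {x : U}
    (hx : pathClass I (Path.nil : Path c c) • x = x) (h : a ≠ c) : pathClass I p • x = 0 := by
  rw [← hx, pathClass_smul_smul_of_ne I _ _ h]

theorem eq_zero_of_forall_nil_smul {x : U}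
    (h : ∀ a : V, pathClass I (Path.nil : Path a a) • x = 0) : x = 0 := by
  rw [← sum_nil_smul I x]
  exact Finset.sum_eq_zero fun a _ => h a

theorem mem_of_forall_nil_smul {N : Submodule (PathAlgebra K V ⧸ I) U} {x : U}
    (h : ∀ a : V, pathClass I (Path.nil : Path a a) • x ∈ N) : x ∈ N := by
  rw [← sum_nil_smul I x]
  exact Submodule.sum_mem _ fun a _ => h a

end PathClass

/-! ### Modules with a mast -/

section Mast

variable {K : Type w} {V : Type u} [Quiver.{v} V] [Field K] [Fintype V]
  (I : Ideal (PathAlgebra K V)) [I.IsTwoSided]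
  {U : Type*} [AddCommGroup U] [Module (PathAlgebra K V ⧸ I) U]

variable {I} in
@[elab_as_elim]
theorem quotient_induction {P : PathAlgebra K V ⧸ I → Prop} (r : PathAlgebra K V ⧸ I) (zero : P 0)
    (add : ∀ x y, P x → P y → P (x + y))
    (smul : ∀ (k : K) {a b : V} (p : Path a b), P (k • pathClass I p)) : P r := by
  obtain ⟨r, rfl⟩ := Ideal.Quotient.mk_surjective r
  induction r using PathAlgebra.induction with
  | zero => simpa using zero
  | add x y hx hy => rw [map_add]; exact add _ _ hx hy
  | smul k p => exact smul k p

variable [Module K U]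

/-- `x` is a top element of `U` of mast `p`: the initial segments of `p` applied to `x` span `U`,
and none of them vanishes. -/
structure HasMast {a b : V} (p : Path a b) (x : U) : Prop where
  nil_smul : pathClass I (Path.nil : Path a a) • x = x
  ne_zero : pathClass I p • x ≠ 0
  nil_smul_eq (c : V) (y : U) : pathClass I (Path.nil : Path c c) • y = 0 ∨
    ∃ (q : Path a c) (r : Path c b) (k : K), q.comp r = p ∧
      pathClass I (Path.nil : Path c c) • y = k • pathClass I q • x

/-- The span of the elements obtained by applying the initial segments of a path to `x`. -/
def mastSpan {a : V} (x : U) : {b : V} → Path a b → Submodule K U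
  | _, Path.nil => Submodule.span K {pathClass I (Path.nil : Path a a) • x}
  | _, Path.cons p α => mastSpan x p ⊔ Submodule.span K {pathClass I (p.cons α) • x}

theorem smul_mem_mastSpan {a b c : V} (x : U) (q : Path a c) (r : Path c b) :
    pathClass I q • x ∈ mastSpan I x (q.comp r) := by
  induction r with
  | nil =>
    cases q with
    | nil => exact Submodule.mem_span_singleton_self _
    | cons q α => exact Submodule.mem_sup_right (Submodule.mem_span_singleton_self _)
  | cons r α ih => exact Submodule.mem_sup_left ih

theorem mastSpan_fg {a b : V} (x : U) (p : Path a b) : (mastSpan I x p).FG := by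
  induction p with
  | nil => exact Submodule.fg_span_singleton _
  | cons p α ih => exact ih.sup (Submodule.fg_span_singleton _)

theorem HasMast.mastSpan_eq_top {a b : V} {p : Path a b} {x : U} (h : HasMast I p x) :
    mastSpan I x p = ⊤ := by
  refine eq_top_iff.2 fun y _ => ?_
  rw [← sum_nil_smul I y]
  refine Submodule.sum_mem _ fun c _ => ?_
  obtain h0 | ⟨q, r, k, rfl, h0⟩ := h.nil_smul_eq c y
  · rw [h0]; exact Submodule.zero_mem _
  · rw [h0]; exact Submodule.smul_mem _ _ (smul_mem_mastSpan I x q r)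

theorem HasMast.finite {a b : V} {p : Path a b} {x : U} (h : HasMast I p x) : Module.Finite K U :=
  ⟨h.mastSpan_eq_top ▸ mastSpan_fg I x p⟩

variable [IsScalarTower K (PathAlgebra K V ⧸ I) U]

/-- By acyclicity the end of `p.cons α` is not visited by `p`, so a trivial path selects at most one
of the spanning vectors. -/
theorem nil_smul_of_mem_mastSpan (hV : IsAcyclicQuiver V) {a b : V} {p : Path a b} {x : U} (c : V)
    {y : U} (hy : y ∈ mastSpan I x p) : pathClass I (Path.nil : Path c c) • y = 0 ∨
      ∃ (q : Path a c) (r : Path c b) (k : K), q.comp r = p ∧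
        pathClass I (Path.nil : Path c c) • y = k • pathClass I q • x := by
  induction p generalizing y with
  | nil =>
    obtain ⟨k, rfl⟩ := Submodule.mem_span_singleton.1 hy
    by_cases hc : c = a
    · subst hc
      exact Or.inr ⟨Path.nil, Path.nil, k, rfl, by rw [smul_comm, nil_smul_pathClass_smul]⟩
    · left
      rw [smul_comm, pathClass_smul_smul_of_ne I _ _ hc, smul_zero]
  | @cons d b p α ih =>
    obtain ⟨y, hy', z, hz, rfl⟩ := Submodule.mem_sup.1 hy
    obtain ⟨k, rfl⟩ := Submodule.mem_span_singleton.1 hz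
    rw [smul_add, smul_comm]
    by_cases hc : c = b
    · subst hc
      right
      refine ⟨p.cons α, Path.nil, k, rfl, ?_⟩
      obtain h0 | ⟨q, r, l, -, h0⟩ := ih hy'
      · rw [h0, zero_add, nil_smul_pathClass_smul]
      · exact ((hV.isEmpty_hom r).false α).elim
    · rw [pathClass_smul_smul_of_ne I _ _ hc, smul_zero, add_zero]
      obtain h0 | ⟨q, r, l, rfl, h0⟩ := ih hy'
      · exact Or.inl h0
      · exact Or.inr ⟨q, r.cons α, l, rfl, h0⟩

theorem HasMast.of_mastSpan_eq_top (hV : IsAcyclicQuiver V) {a b : V} {p : Path a b} {x : U}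
    (h₁ : pathClass I (Path.nil : Path a a) • x = x) (h₂ : pathClass I p • x ≠ 0)
    (h₃ : mastSpan I x p = ⊤) : HasMast I p x :=
  ⟨h₁, h₂, fun c _ => nil_smul_of_mem_mastSpan I hV c (h₃ ▸ Submodule.mem_top)⟩

/-- The vectors along a path that does not kill `x` are independent, as they live at distinct
vertices. -/
theorem finrank_mastSpan [Module.Finite K U] (hV : IsAcyclicQuiver V) {a b : V} (p : Path a b)
    {x : U} (h : pathClass I p • x ≠ 0) : Module.finrank K (mastSpan I x p) = p.length + 1 := by
  induction p with
  | nil => exact finrank_span_singleton h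
  | @cons d b p α ih =>
    have hp : pathClass I p • x ≠ 0 := fun h0 => h <| by
      have := pathClass_smul_smul I α.toPath p x
      rw [h0, smul_zero] at this
      exact this.symm
    have hn : pathClass I (p.cons α) • x ∉ mastSpan I x p := fun hm => by
      obtain h0 | ⟨q, r, l, -, h0⟩ := nil_smul_of_mem_mastSpan I hV b hm
      · rw [nil_smul_pathClass_smul] at h0
        exact h h0
      · exact ((hV.isEmpty_hom r).false α).elim
    rw [mastSpan, Submodule.finrank_sup_span_singleton hn, ih hp, Path.length_cons]

theorem HasMast.finrank_eq (hV : IsAcyclicQuiver V) {a b : V} {p : Path a b} {x : U}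
    (h : HasMast I p x) : Module.finrank K U = p.length + 1 := by
  have := h.finite
  rw [← finrank_mastSpan I hV p h.ne_zero, h.mastSpan_eq_top, finrank_top]

variable {I}
variable {a b : V} {p : Path a b} {x : U}

theorem HasMast.exists_smul_mem (h : HasMast I p x) {N : Submodule (PathAlgebra K V ⧸ I) U} {y : U}
    (hy : y ∈ N) {c : V} (hc : pathClass I (Path.nil : Path c c) • y ≠ 0) :
    ∃ (q : Path a c) (r : Path c b), q.comp r = p ∧ pathClass I q • x ∈ N := by
  obtain h0 | ⟨q, r, k, hp, h0⟩ := h.nil_smul_eq c y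
  · exact (hc h0).elim
  refine ⟨q, r, hp, ?_⟩
  have hk : k ≠ 0 := fun hk => hc (by rw [h0, hk, zero_smul])
  have : pathClass I q • x = k⁻¹ • pathClass I (Path.nil : Path c c) • y := by
    rw [h0, inv_smul_smul₀ hk]
  rw [this]
  exact Submodule.smul_of_tower_mem N _ (N.smul_mem _ hy)

/-- A submodule contains the component of its elements at each vertex, hence is governed by the
vectors `q x` it contains. Initial segments are comparable, and the longer one gives a multiple of
the shorter one. -/
theorem HasMast.isUniserialModule (h : HasMast I p x) :
    IsUniserialModule (PathAlgebra K V ⧸ I) U where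
  finite := by
    have := h.finite
    exact Module.Finite.of_restrictScalars_finite K _ _
  nontrivial := ⟨_, _, h.ne_zero⟩
  total N N' := by
    by_contra! hN
    obtain ⟨y, hy, hy'⟩ := Set.not_subset.1 hN.1
    obtain ⟨z, hz, hz'⟩ := Set.not_subset.1 hN.2
    obtain ⟨c, hc⟩ : ∃ c : V, pathClass I (Path.nil : Path c c) • y ∉ N' := by
      by_contra! H; exact hy' (mem_of_forall_nil_smul I H)
    obtain ⟨d, hd⟩ : ∃ c : V, pathClass I (Path.nil : Path c c) • z ∉ N := by
      by_contra! H; exact hz' (mem_of_forall_nil_smul I H)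
    obtain h0 | ⟨q, r, k, hp, h0⟩ := h.nil_smul_eq c y
    · exact hc (h0 ▸ N'.zero_mem)
    obtain h1 | ⟨q', r', k', hp', h1⟩ := h.nil_smul_eq d z
    · exact hd (h1 ▸ N.zero_mem)
    have hc0 : pathClass I (Path.nil : Path c c) • y ≠ 0 := fun e => hc (e ▸ N'.zero_mem)
    have hd0 : pathClass I (Path.nil : Path d d) • z ≠ 0 := fun e => hd (e ▸ N.zero_mem)
    have hk : k ≠ 0 := fun e => hc0 (by rw [h0, e, zero_smul])
    have hk' : k' ≠ 0 := fun e => hd0 (by rw [h1, e, zero_smul])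
    have hq : pathClass I q • x ∈ N := by
      rw [← inv_smul_smul₀ hk (pathClass I q • x), ← h0]
      exact Submodule.smul_of_tower_mem N _ (N.smul_mem _ hy)
    have hq' : pathClass I q' • x ∈ N' := by
      rw [← inv_smul_smul₀ hk' (pathClass I q' • x), ← h1]
      exact Submodule.smul_of_tower_mem N' _ (N'.smul_mem _ hz)
    obtain ⟨s, rfl⟩ | ⟨s, rfl⟩ := Path.comparable_of_comp_eq_comp q r q' r' (hp.trans hp'.symm)
    · refine hd ?_
      rw [h1, ← pathClass_smul_smul]
      exact Submodule.smul_of_tower_mem N _ (N.smul_mem _ hq)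
    · refine hc ?_
      rw [h0, ← pathClass_smul_smul]
      exact Submodule.smul_of_tower_mem N' _ (N'.smul_mem _ hq')

/-- The last element of a mast spans a one-dimensional submodule. -/
theorem HasMast.smul_last (hV : IsAcyclicQuiver V) (h : HasMast I p x) (r : PathAlgebra K V) :
    Ideal.Quotient.mk I r • pathClass I p • x =
      coeff K (Path.nil : Path b b) r • pathClass I p • x := by
  induction r using PathAlgebra.induction with
  | zero => simp
  | add r s hr hs => rw [map_add, map_add, add_smul, add_smul, hr, hs]
  | @smul k c d q =>
    rw [mk_smul_eq, map_smul, smul_assoc, smul_assoc]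
    congr 1
    change pathClass I q • _ = _
    by_cases hc : c = b
    · subst hc
      obtain hq | hq := Nat.eq_zero_or_pos q.length
      · obtain rfl := Path.eq_of_length_zero q hq
        rw [Path.eq_nil_of_length_zero q hq, coeff_self, one_smul, nil_smul_pathClass_smul]
      · rw [coeff_of_length_ne _ _ (by simpa using hq.ne'), zero_smul]
        obtain h0 | ⟨q', r', k', hp, -⟩ := h.nil_smul_eq d (pathClass I q • pathClass I p • x)
        · rwa [nil_smul_pathClass_smul] at h0
        · have := hV c (q.comp r')
          rw [Path.length_comp] at this
          omega
    · rw [pathClass_smul_smul_of_ne I _ _ hc, coeff_of_start_ne _ _ hc, zero_smul]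

/-- Dual to `HasMast.smul_last`: a path of positive length ending at `a` acts as zero, since its
start would otherwise be reached by `p` and close a cycle. -/
theorem HasMast.nil_smul_smul (hV : IsAcyclicQuiver V) (h : HasMast I p x) (r : PathAlgebra K V)
    (y : U) : pathClass I (Path.nil : Path a a) • Ideal.Quotient.mk I r • y =
      coeff K (Path.nil : Path a a) r • pathClass I (Path.nil : Path a a) • y := by
  induction r using PathAlgebra.induction with
  | zero => simp
  | add r s hr hs => rw [map_add, map_add, add_smul, add_smul, smul_add, hr, hs]
  | @smul k c d q =>
    rw [mk_smul_eq, map_smul, smul_assoc, smul_assoc, smul_comm]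
    congr 1
    change _ • pathClass I q • _ = _
    by_cases hd : d = a
    · subst hd
      obtain hq | hq := Nat.eq_zero_or_pos q.length
      · obtain rfl := Path.eq_of_length_zero q hq
        rw [Path.eq_nil_of_length_zero q hq, coeff_self, one_smul, nil_smul_pathClass_smul]
      · rw [coeff_of_length_ne _ _ (by simpa using hq.ne'), zero_smul]
        obtain h0 | ⟨q', r', k', hp, -⟩ := h.nil_smul_eq c y
        · rw [← pathClass_smul_nil_smul I q, h0, smul_zero, smul_zero]
        · have := hV c (q.comp q')
          rw [Path.length_comp] at this
          omega
    · rw [pathClass_smul_smul_of_ne I _ _ (Ne.symm hd), coeff_of_end_ne _ _ hd, zero_smul]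

/-- The element `x` generates the module. -/
theorem HasMast.span_eq_top (h : HasMast I p x) :
    Submodule.span (PathAlgebra K V ⧸ I) {x} = ⊤ := by
  refine eq_top_iff.2 fun y _ => mem_of_forall_nil_smul I fun c => ?_
  obtain h0 | ⟨q, r, k, hp, h0⟩ := h.nil_smul_eq c y
  · rw [h0]; exact Submodule.zero_mem _
  · rw [h0]
    exact Submodule.smul_of_tower_mem _ _
      (Submodule.smul_mem _ _ (Submodule.mem_span_singleton_self x))

end Mast

/-- Cyclic modules whose generators have the same annihilator are isomorphic. -/
theorem nonempty_linearEquiv_of_smul_eq_zero_iff {R M M' : Type*} [Ring R] [AddCommGroup M]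
    [Module R M] [AddCommGroup M'] [Module R M'] {x : M} {x' : M'}
    (hx : Submodule.span R {x} = ⊤) (hx' : Submodule.span R {x'} = ⊤)
    (h : ∀ r : R, r • x = 0 ↔ r • x' = 0) : Nonempty (M ≃ₗ[R] M') := by
  have e : LinearMap.ker (LinearMap.toSpanSingleton R M x) =
      LinearMap.ker (LinearMap.toSpanSingleton R M' x') := by
    ext r
    simpa using h r
  exact ⟨((LinearMap.toSpanSingleton R M x).quotKerEquivOfSurjective
    (by rw [← LinearMap.range_eq_top, LinearMap.range_toSpanSingleton, hx])).symm.trans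
    ((Submodule.quotEquivOfEq _ _ e).trans
      ((LinearMap.toSpanSingleton R M' x').quotKerEquivOfSurjective
        (by rw [← LinearMap.range_eq_top, LinearMap.range_toSpanSingleton, hx'])))⟩

/-- The supremum of a nonempty finite chain of submodules is one of its members. -/
theorem exists_iSup_eq_of_total {R M ι : Type*} [Ring R] [AddCommGroup M] [Module R M] [Finite ι]
    (h : ∀ N N' : Submodule R M, N ≤ N' ∨ N' ≤ N) (f : ι → Submodule R M) (hf : ⨆ i, f i ≠ ⊥) :
    ∃ i, ⨆ i, f i = f i := by
  have : Nonempty ι := by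
    by_contra H
    rw [not_nonempty_iff] at H
    exact hf (iSup_of_empty f)
  have D : Directed (· ≤ ·) f := fun i j =>
    (h (f i) (f j)).elim (fun e => ⟨j, e, le_rfl⟩) fun e => ⟨i, le_rfl, e⟩
  obtain ⟨i, hi⟩ := D.finite_le (id : ι → ι)
  exact ⟨i, le_antisymm (iSup_le hi) (le_iSup f i)⟩

/-! ### Simple modules -/

section Simple

variable {K : Type w} {V : Type u} [Quiver.{v} V] [Field K] [Fintype V]
  (I : Ideal (PathAlgebra K V)) [I.IsTwoSided]

/-- `S` is a simple module supported at the vertex `a`. -/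
structure IsVertexSimple (a : V) (S : Type*) [AddCommGroup S] [Module (PathAlgebra K V ⧸ I) S] :
    Prop where
  simple : IsSimpleModule (PathAlgebra K V ⧸ I) S
  nil_smul (s : S) : pathClass I (Path.nil : Path a a) • s = s

variable {S S' : Type*} [AddCommGroup S] [Module (PathAlgebra K V ⧸ I) S]
  [AddCommGroup S'] [Module (PathAlgebra K V ⧸ I) S']

variable {I}

theorem IsVertexSimple.congr {a : V} (h : IsVertexSimple I a S)
    (e : S ≃ₗ[PathAlgebra K V ⧸ I] S') : IsVertexSimple I a S' where
  simple := have := h.simple; IsSimpleModule.congr e.symm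
  nil_smul s := by
    obtain ⟨s, rfl⟩ := e.surjective s
    rw [← map_smul, h.nil_smul]

theorem IsVertexSimple.vertex_unique {a a' : V} (h : IsVertexSimple I a S)
    (h' : IsVertexSimple I a' S) : a = a' := by
  have := h.simple
  have := IsSimpleModule.nontrivial (PathAlgebra K V ⧸ I) S
  obtain ⟨s, hs⟩ := exists_ne (0 : S)
  by_contra hne
  apply hs
  rw [← h.nil_smul s, ← h'.nil_smul s, pathClass_smul_smul_of_ne I _ _ hne]

variable (I) in
theorem nil_mul_mul_pathClass (hV : IsAcyclicQuiver V) {a b : V} (q : Path a b) (hq : q.length ≠ 0)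
    (r : PathAlgebra K V ⧸ I) : pathClass I (Path.nil : Path a a) * r * pathClass I q = 0 := by
  induction r using quotient_induction with
  | zero => simp
  | add x y hx hy => rw [mul_add, add_mul, hx, hy, add_zero]
  | @smul k c d p =>
    rw [mul_smul_comm, smul_mul_assoc, mul_assoc]
    by_cases hc : c = b
    · subst hc
      rw [pathClass_mul]
      by_cases hd : d = a
      · subst hd
        have := hV d (q.comp p)
        rw [Path.length_comp] at this
        omega
      · rw [pathClass_mul_of_ne I _ _ (Ne.symm hd), smul_zero]
    · rw [pathClass_mul_of_ne I _ _ hc, mul_zero, smul_zero]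

/-- If `q s` were nonzero it would generate the simple module, so the component of `s` at the start
of `q` would be recovered by returning from the end of `q` to its start, along a cycle. -/
theorem pathClass_smul_eq_zero_of_simple (hV : IsAcyclicQuiver V)
    [IsSimpleModule (PathAlgebra K V ⧸ I) S] {a b : V} (q : Path a b) (hq : q.length ≠ 0) (s : S) :
    pathClass I q • s = 0 := by
  by_contra h
  obtain ⟨r, hr⟩ := IsSimpleModule.toSpanSingleton_surjective (PathAlgebra K V ⧸ I) h
    (pathClass I (Path.nil : Path a a) • s)
  rw [LinearMap.toSpanSingleton_apply] at hr
  have h0 : pathClass I (Path.nil : Path a a) • s = 0 := by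
    rw [← nil_smul_pathClass_smul, ← hr, smul_smul, smul_smul,
      nil_mul_mul_pathClass I hV q hq, zero_smul]
  exact h (by rw [← pathClass_smul_nil_smul, h0, smul_zero])

theorem pathClass_mem_jacobson (hV : IsAcyclicQuiver V) {a b : V} (q : Path a b)
    (hq : q.length ≠ 0) : pathClass I q ∈ Ring.jacobson (PathAlgebra K V ⧸ I) := by
  refine Submodule.mem_sInf.2 fun m hm => ?_
  have := isSimpleModule_iff_isCoatom.2 hm
  rw [← Submodule.Quotient.mk_eq_zero, ← mul_one (pathClass I q), ← smul_eq_mul,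
    Submodule.Quotient.mk_smul]
  exact pathClass_smul_eq_zero_of_simple hV q hq _

variable [Module K S] [IsScalarTower K (PathAlgebra K V ⧸ I) S]

/-- Only the trivial path at the vertex of `s` survives, so `K s` is already a submodule. This is
why simples are one-dimensional over any field `K`. -/
theorem mk_smul_of_simple (hV : IsAcyclicQuiver V)
    [IsSimpleModule (PathAlgebra K V ⧸ I) S] {a : V} {s : S}
    (hs : pathClass I (Path.nil : Path a a) • s = s) (r : PathAlgebra K V) :
    Ideal.Quotient.mk I r • s = coeff K (Path.nil : Path a a) r • s := by
  induction r using PathAlgebra.induction with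
  | zero => simp
  | add r s hr hs => rw [map_add, map_add, add_smul, add_smul, hr, hs]
  | @smul k c d q =>
    rw [mk_smul_eq, map_smul, smul_assoc, smul_assoc]
    congr 1
    change pathClass I q • _ = _
    by_cases hq : q.length = 0
    · obtain rfl := Path.eq_of_length_zero q hq
      obtain rfl := Path.eq_nil_of_length_zero q hq
      by_cases hc : c = a
      · subst hc
        rw [coeff_self, one_smul, hs]
      · rw [coeff_of_start_ne _ _ hc, zero_smul, pathClass_smul_of_ne I _ hs hc]
    · rw [pathClass_smul_eq_zero_of_simple hV q hq, coeff_of_length_ne _ _ (by simpa using hq),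
        zero_smul]

theorem IsVertexSimple.mk_smul (hV : IsAcyclicQuiver V) {a : V} (h : IsVertexSimple I a S)
    (r : PathAlgebra K V) (s : S) :
    Ideal.Quotient.mk I r • s = coeff K (Path.nil : Path a a) r • s :=
  have := h.simple
  mk_smul_of_simple hV (h.nil_smul s) r

variable (I) in
theorem exists_nil_smul_eq_of_simple (S : Type*) [AddCommGroup S]
    [Module (PathAlgebra K V ⧸ I) S] [IsSimpleModule (PathAlgebra K V ⧸ I) S] :
    ∃ (a : V) (s : S), s ≠ 0 ∧ pathClass I (Path.nil : Path a a) • s = s := by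
  have := IsSimpleModule.nontrivial (PathAlgebra K V ⧸ I) S
  obtain ⟨s, hs⟩ := exists_ne (0 : S)
  obtain ⟨a, ha⟩ : ∃ a : V, pathClass I (Path.nil : Path a a) • s ≠ 0 := by
    by_contra! H; exact hs (eq_zero_of_forall_nil_smul I H)
  exact ⟨a, _, ha, nil_smul_pathClass_smul I _ _⟩

theorem exists_smul_eq_of_simple (hV : IsAcyclicQuiver V)
    [IsSimpleModule (PathAlgebra K V ⧸ I) S] {a : V} {s : S} (h0 : s ≠ 0)
    (hs : pathClass I (Path.nil : Path a a) • s = s) (t : S) : ∃ k : K, k • s = t := by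
  obtain ⟨r, hr⟩ := IsSimpleModule.toSpanSingleton_surjective (PathAlgebra K V ⧸ I) h0 t
  obtain ⟨r, rfl⟩ := Ideal.Quotient.mk_surjective r
  rw [LinearMap.toSpanSingleton_apply, mk_smul_of_simple hV hs] at hr
  exact ⟨_, hr⟩

theorem length_eq_one_of_simple (hV : IsAcyclicQuiver V)
    [IsSimpleModule (PathAlgebra K V ⧸ I) S] : Module.length K S = 1 := by
  obtain ⟨a, s, h0, hs⟩ := exists_nil_smul_eq_of_simple I S
  have : Module.finrank K S = 1 :=
    finrank_eq_one s h0 (exists_smul_eq_of_simple hV h0 hs)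
  have hf : Module.Finite K S := Module.finite_of_finrank_eq_succ this
  rw [Module.length_eq_finrank, this, Nat.cast_one]

variable (I) in
theorem exists_isVertexSimple (hV : IsAcyclicQuiver V) (S : Type*) [AddCommGroup S]
    [Module (PathAlgebra K V ⧸ I) S] (hS : IsSimpleModule (PathAlgebra K V ⧸ I) S) :
    ∃ a : V, IsVertexSimple I a S := by
  let _ : Module K S := Module.compHom S (algebraMap K (PathAlgebra K V ⧸ I))
  have : IsScalarTower K (PathAlgebra K V ⧸ I) S := IsScalarTower.of_algebraMap_smul fun _ _ => rfl
  obtain ⟨a, s, h0, hs⟩ := exists_nil_smul_eq_of_simple I S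
  refine ⟨a, hS, fun t => ?_⟩
  obtain ⟨k, rfl⟩ := exists_smul_eq_of_simple hV h0 hs t
  rw [smul_comm, hs]

end Simple

/-! ### Simples at a common vertex, and composition length as `K`-dimension -/

section Length

variable {K : Type w} {V : Type u} [Quiver.{v} V] [Field K] [Fintype V]
  {I : Ideal (PathAlgebra K V)} [I.IsTwoSided]

theorem IsVertexSimple.nonempty_linearEquiv (hV : IsAcyclicQuiver V) {a : V} {S S' : Type*}
    [AddCommGroup S] [Module (PathAlgebra K V ⧸ I) S]
    [AddCommGroup S'] [Module (PathAlgebra K V ⧸ I) S'] (h : IsVertexSimple I a S)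
    (h' : IsVertexSimple I a S') : Nonempty (S ≃ₗ[PathAlgebra K V ⧸ I] S') := by
  let _ : Module K S := Module.compHom S (algebraMap K (PathAlgebra K V ⧸ I))
  have : IsScalarTower K (PathAlgebra K V ⧸ I) S := IsScalarTower.of_algebraMap_smul fun _ _ => rfl
  let _ : Module K S' := Module.compHom S' (algebraMap K (PathAlgebra K V ⧸ I))
  have : IsScalarTower K (PathAlgebra K V ⧸ I) S' := IsScalarTower.of_algebraMap_smul fun _ _ => rfl
  have := h.simple
  have := h'.simple
  have := IsSimpleModule.nontrivial (PathAlgebra K V ⧸ I) S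
  have := IsSimpleModule.nontrivial (PathAlgebra K V ⧸ I) S'
  obtain ⟨s, hs⟩ := exists_ne (0 : S)
  obtain ⟨s', hs'⟩ := exists_ne (0 : S')
  refine nonempty_linearEquiv_of_smul_eq_zero_iff
    (IsSimpleModule.span_singleton_eq_top _ hs) (IsSimpleModule.span_singleton_eq_top _ hs')
    fun r => ?_
  obtain ⟨r, rfl⟩ := Ideal.Quotient.mk_surjective r
  rw [h.mk_smul hV, h'.mk_smul hV, smul_eq_zero_iff_left hs, smul_eq_zero_iff_left hs']

theorem length_eq_length_of_isFiniteLength (hV : IsAcyclicQuiver V) {U : Type*} [AddCommGroup U]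
    [Module (PathAlgebra K V ⧸ I) U] (h : IsFiniteLength (PathAlgebra K V ⧸ I) U) [Module K U]
    [IsScalarTower K (PathAlgebra K V ⧸ I) U] :
    Module.length K U = Module.length (PathAlgebra K V ⧸ I) U := by
  -- The `K`-structure must vary with the module in the induction on composition series.
  revert ‹Module K U›
  induction h with
  | of_subsingleton => intros; rw [Module.length_eq_zero, Module.length_eq_zero]
  | @of_simple_quotient M _ _ N _ _ ih =>
    intro _ _
    rw [Module.length_eq_add_of_exact N.subtype N.mkQ N.subtype_injective N.mkQ_surjective
        (LinearMap.exact_subtype_mkQ N),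
      Module.length_eq_add_of_exact (N.subtype.restrictScalars K) (N.mkQ.restrictScalars K)
        N.subtype_injective N.mkQ_surjective (LinearMap.exact_subtype_mkQ N), ih,
      Module.length_eq_one (PathAlgebra K V ⧸ I) (M ⧸ N),
      length_eq_one_of_simple (I := I) (S := M ⧸ N) hV]

variable {U : Type*} [AddCommGroup U] [Module (PathAlgebra K V ⧸ I) U] [Module K U]
  [IsScalarTower K (PathAlgebra K V ⧸ I) U]

variable (I) in
theorem length_eq_finrank (hV : IsAcyclicQuiver V) [Module.Finite K U] :
    Module.length (PathAlgebra K V ⧸ I) U = Module.finrank K U := by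
  rw [← Module.length_eq_finrank, length_eq_length_of_isFiniteLength (I := I) hV]
  rw [isFiniteLength_iff_isNoetherian_isArtinian]
  exact ⟨isNoetherian_of_tower K inferInstance, isArtinian_of_tower K inferInstance⟩

theorem HasMast.length_eq (hV : IsAcyclicQuiver V) {a b : V} {p : Path a b} {x : U}
    (h : HasMast I p x) : Module.length (PathAlgebra K V ⧸ I) U = p.length + 1 := by
  have := h.finite
  rw [length_eq_finrank I hV, h.finrank_eq I hV, Nat.cast_add, Nat.cast_one]

end Length

/-! ### Every uniserial module has a mast -/

section Existence

variable {K : Type w} {V : Type u} [Quiver.{v} V] [Field K] [Fintype V]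
  (I : Ideal (PathAlgebra K V)) [I.IsTwoSided]
  {U : Type*} [AddCommGroup U] [Module (PathAlgebra K V ⧸ I) U]

/-- The submodule generated by the arrows out of the end of `p`, applied to `p x`. -/
def arrowSpan {a b : V} (p : Path a b) (x : U) : Submodule (PathAlgebra K V ⧸ I) U :=
  ⨆ β : (Σ c : V, b ⟶ c), Submodule.span (PathAlgebra K V ⧸ I) {pathClass I (p.cons β.2) • x}

theorem pathClass_comp_smul_mem_arrowSpan {a b c : V} (p : Path a b) (q : Path b c)
    (hq : q.length ≠ 0) (x : U) : pathClass I (p.comp q) • x ∈ arrowSpan I p x := by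
  obtain ⟨d, β, q, rfl, -⟩ := (Path.length_ne_zero_iff_eq_comp q).1 hq
  refine Submodule.mem_iSup_of_mem ⟨d, β⟩ (Submodule.mem_span_singleton.2 ⟨pathClass I q, ?_⟩)
  rw [pathClass_smul_smul, ← Path.comp_toPath_eq_cons, Path.comp_assoc]

/-- The vertex components of finitely many generators generate finitely many cyclic submodules whose
sum is `U`. These form a chain, so one of them is everything. -/
theorem IsUniserialModule.exists_generator (h : IsUniserialModule (PathAlgebra K V ⧸ I) U) :
    ∃ (a : V) (x : U), pathClass I (Path.nil : Path a a) • x = x ∧ x ≠ 0 ∧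
      Submodule.span (PathAlgebra K V ⧸ I) {x} = ⊤ := by
  obtain ⟨s, hs⟩ := h.finite.fg_top
  have := h.nontrivial
  have htop : ⨆ i : V × s, Submodule.span (PathAlgebra K V ⧸ I)
      {pathClass I (Path.nil : Path i.1 i.1) • (i.2 : U)} = ⊤ := by
    rw [eq_top_iff, ← hs, Submodule.span_le]
    intro y hy
    refine mem_of_forall_nil_smul I fun c => ?_
    exact Submodule.mem_iSup_of_mem (⟨c, y, hy⟩ : V × s) (Submodule.mem_span_singleton_self _)
  obtain ⟨⟨c, y⟩, hy⟩ := exists_iSup_eq_of_total h.total _ (htop ▸ top_ne_bot)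
  rw [htop] at hy
  refine ⟨c, _, nil_smul_pathClass_smul I _ _, fun h0 => ?_, hy.symm⟩
  rw [h0, Submodule.span_zero_singleton] at hy
  exact top_ne_bot hy

theorem IsUniserialModule.exists_arrow [∀ a b : V, Finite (a ⟶ b)]
    (h : IsUniserialModule (PathAlgebra K V ⧸ I) U) {a b : V} (p : Path a b) (x : U)
    (hp : arrowSpan I p x ≠ ⊥) : ∃ (c : V) (β : b ⟶ c), pathClass I (p.cons β) • x ≠ 0 ∧
      arrowSpan I p x = Submodule.span _ {pathClass I (p.cons β) • x} := by
  obtain ⟨⟨c, β⟩, hβ⟩ := exists_iSup_eq_of_total h.total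
    (fun β : (Σ c : V, b ⟶ c) => Submodule.span (PathAlgebra K V ⧸ I)
      {pathClass I (p.cons β.2) • x}) hp
  refine ⟨c, β, fun h0 => hp ?_, hβ⟩
  rw [arrowSpan, hβ, h0, Submodule.span_zero_singleton]

variable [Module K U] [IsScalarTower K (PathAlgebra K V ⧸ I) U]

theorem mem_span_sup_arrowSpan {a b : V} (p : Path a b) {x y : U}
    (hy : y ∈ Submodule.span (PathAlgebra K V ⧸ I) {pathClass I p • x}) :
    y ∈ Submodule.span K {pathClass I p • x} ⊔ (arrowSpan I p x).restrictScalars K := by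
  obtain ⟨r, rfl⟩ := Submodule.mem_span_singleton.1 hy
  induction r using quotient_induction with
  | zero => rw [zero_smul]; exact Submodule.zero_mem _
  | add r s hr hs =>
    rw [add_smul]
    exact Submodule.add_mem _ (hr (Submodule.smul_mem _ _ (Submodule.mem_span_singleton_self _)))
      (hs (Submodule.smul_mem _ _ (Submodule.mem_span_singleton_self _)))
  | @smul k c d q =>
    rw [smul_assoc]
    refine Submodule.smul_mem _ _ ?_
    by_cases hc : c = b
    · subst hc
      by_cases hq : q.length = 0
      · obtain rfl := Path.eq_of_length_zero q hq
        obtain rfl := Path.eq_nil_of_length_zero q hq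
        rw [nil_smul_pathClass_smul]
        exact Submodule.mem_sup_left (Submodule.mem_span_singleton_self _)
      · rw [pathClass_smul_smul]
        exact Submodule.mem_sup_right (pathClass_comp_smul_mem_arrowSpan I p q hq x)
    · rw [pathClass_smul_smul_of_ne I _ _ hc]
      exact Submodule.zero_mem _

/-- Greedy extension of `p`: as long as some arrow acts nontrivially on `p x`, the chain condition
provides one arrow that generates all of `arrowSpan`. The number `n` bounds the remaining steps,
because paths of length at least `m` vanish modulo `I`; `hx` is the invariant. -/
theorem IsUniserialModule.exists_mastSpan_eq_top [∀ a b : V, Finite (a ⟶ b)] {m : ℕ}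
    (hm : ∀ x ∈ arrowIdealPow K V m, x ∈ I)
    (h : IsUniserialModule (PathAlgebra K V ⧸ I) U) (n : ℕ) {a b : V} (p : Path a b)
    (hn : m ≤ p.length + n) {x : U} (hp : pathClass I p • x ≠ 0)
    (hx : mastSpan I x p ⊔ (arrowSpan I p x).restrictScalars K = ⊤) :
    ∃ (b : V) (p : Path a b), pathClass I p • x ≠ 0 ∧ mastSpan I x p = ⊤ := by
  induction n generalizing b with
  | zero => exact (hp (by rw [pathClass_eq_zero I hm p hn, zero_smul])).elim
  | succ n ih =>
    by_cases h0 : arrowSpan I p x = ⊥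
    · rw [h0, Submodule.restrictScalars_bot, sup_bot_eq] at hx
      exact ⟨b, p, hp, hx⟩
    obtain ⟨c, β, hβ, hs⟩ := h.exists_arrow I p x h0
    refine ih (p.cons β) (by rw [Path.length_cons]; omega) hβ ?_
    rw [eq_top_iff, ← hx, mastSpan, sup_assoc]
    refine sup_le_sup_left ?_ _
    intro y hy
    rw [Submodule.restrictScalars_mem, hs] at hy
    exact mem_span_sup_arrowSpan I (p.cons β) hy

/-- Every uniserial module has a mast. -/
theorem IsUniserialModule.exists_hasMast [∀ a b : V, Finite (a ⟶ b)] {m : ℕ}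
    (hV : IsAcyclicQuiver V) (hm : ∀ x ∈ arrowIdealPow K V m, x ∈ I)
    (h : IsUniserialModule (PathAlgebra K V ⧸ I) U) :
    ∃ (a b : V) (p : Path a b) (x : U), HasMast I p x := by
  obtain ⟨a, x, hx, h0, ht⟩ := h.exists_generator I
  obtain ⟨b, p, hp, hpt⟩ := h.exists_mastSpan_eq_top I hm m (Path.nil : Path a a) (by simp)
    (x := x) (by rwa [hx]) (by
      refine eq_top_iff.2 fun y _ => mem_span_sup_arrowSpan I (Path.nil : Path a a) ?_
      rw [hx, ht]
      exact Submodule.mem_top)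
  exact ⟨a, b, p, x, .of_mastSpan_eq_top I hV hx hp hpt⟩

/-- A path of the right length that does not annihilate a uniserial module is a mast of it. -/
theorem IsUniserialModule.exists_hasMast_of_length_eq [∀ a b : V, Finite (a ⟶ b)] {m : ℕ}
    (hV : IsAcyclicQuiver V) (hm : ∀ x ∈ arrowIdealPow K V m, x ∈ I)
    (h : IsUniserialModule (PathAlgebra K V ⧸ I) U) {a b : V} {p : Path a b}
    (hl : Module.length (PathAlgebra K V ⧸ I) U = p.length + 1) {y : U}
    (hy : pathClass I p • y ≠ 0) : ∃ x : U, HasMast I p x := by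
  obtain ⟨_, _, _, _, h'⟩ := h.exists_hasMast I hV hm
  have := h'.finite
  rw [length_eq_finrank I hV] at hl
  rw [← pathClass_smul_nil_smul] at hy
  refine ⟨_, .of_mastSpan_eq_top I hV (nil_smul_pathClass_smul I _ _) hy ?_⟩
  -- Dimension count: the vectors along `p` are independent, and their number is the length of `U`.
  refine Submodule.eq_top_of_finrank_eq ?_
  rw [finrank_mastSpan I hV p hy]
  exact_mod_cast hl.symm

end Existence

/-! ### Top and socle of a module with a mast -/

section TopSocle

variable {K : Type w} {V : Type u} [Quiver.{v} V] [Field K] [Fintype V]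
  {I : Ideal (PathAlgebra K V)} [I.IsTwoSided]
  {U : Type*} [AddCommGroup U] [Module (PathAlgebra K V ⧸ I) U]
  [Module K U] [IsScalarTower K (PathAlgebra K V ⧸ I) U]
  {a b : V} {p : Path a b} {x : U}

theorem HasMast.eq_top_of_mem (h : HasMast I p x) {N : Submodule (PathAlgebra K V ⧸ I) U}
    (hx : x ∈ N) : N = ⊤ := by
  rw [eq_top_iff, ← h.span_eq_top, Submodule.span_singleton_le_iff_mem]
  exact hx

/-- A nonzero submodule contains some `q x`, and the rest of `p` carries `q x` to `p x`. Thus `p x`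
generates the smallest nonzero submodule. -/
theorem HasMast.smul_mem_of_ne_bot (h : HasMast I p x)
    {N : Submodule (PathAlgebra K V ⧸ I) U} (hN : N ≠ ⊥) : pathClass I p • x ∈ N := by
  obtain ⟨y, hy, h0⟩ := Submodule.exists_mem_ne_zero_of_ne_bot hN
  obtain ⟨c, hc⟩ : ∃ c : V, pathClass I (Path.nil : Path c c) • y ≠ 0 := by
    by_contra! H; exact h0 (eq_zero_of_forall_nil_smul I H)
  obtain ⟨q, r, rfl, hq⟩ := h.exists_smul_mem hy hc
  rw [← pathClass_smul_smul]
  exact N.smul_mem _ hq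

theorem HasMast.isAtom_span (h : HasMast I p x) :
    IsAtom (Submodule.span (PathAlgebra K V ⧸ I) {pathClass I p • x}) := by
  refine ⟨fun e => h.ne_zero (Submodule.span_singleton_eq_bot.1 e), fun N hN => ?_⟩
  by_contra h0
  exact hN.not_ge ((Submodule.span_singleton_le_iff_mem _ _).2 (h.smul_mem_of_ne_bot h0))

theorem HasMast.moduleSocle_eq (h : HasMast I p x) :
    moduleSocle (PathAlgebra K V ⧸ I) U = Submodule.span _ {pathClass I p • x} := by
  refine le_antisymm (sSup_le fun N hN => ?_) (le_sSup ?_)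
  · have hN : IsAtom N := isSimpleModule_iff_isAtom.1 hN
    have := (Submodule.span_singleton_le_iff_mem _ _).2 (h.smul_mem_of_ne_bot hN.1)
    exact ((hN.le_iff.1 this).resolve_left h.isAtom_span.1).ge
  · exact isSimpleModule_iff_isAtom.2 h.isAtom_span

theorem HasMast.isVertexSimple_moduleSocle (hV : IsAcyclicQuiver V) (h : HasMast I p x) :
    IsVertexSimple I b (moduleSocle (PathAlgebra K V ⧸ I) U) where
  simple := by
    rw [h.moduleSocle_eq]
    exact isSimpleModule_iff_isAtom.2 h.isAtom_span
  nil_smul := by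
    rintro ⟨s, hs⟩
    refine Subtype.ext ?_
    change pathClass I (Path.nil : Path b b) • s = s
    rw [h.moduleSocle_eq] at hs
    obtain ⟨r, rfl⟩ := Submodule.mem_span_singleton.1 hs
    obtain ⟨r, rfl⟩ := Ideal.Quotient.mk_surjective r
    rw [h.smul_last hV, smul_comm, nil_smul_pathClass_smul]

theorem HasMast.nil_smul_mem_jacobson_smul (hV : IsAcyclicQuiver V) (h : HasMast I p x) {c : V}
    (hc : c ≠ a) (y : U) : pathClass I (Path.nil : Path c c) • y ∈
      (Ring.jacobson (PathAlgebra K V ⧸ I) • ⊤ : Submodule (PathAlgebra K V ⧸ I) U) := by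
  obtain h0 | ⟨q, r, k, hp, h0⟩ := h.nil_smul_eq c y
  · rw [h0]; exact Submodule.zero_mem _
  · rw [h0]
    refine Submodule.smul_of_tower_mem _ _ (Submodule.smul_mem_smul ?_ Submodule.mem_top)
    exact pathClass_mem_jacobson hV q fun e => hc (Path.eq_of_length_zero q e).symm

theorem HasMast.isVertexSimple_moduleTop (hV : IsAcyclicQuiver V) (h : HasMast I p x) :
    IsVertexSimple I a (ModuleTop (PathAlgebra K V ⧸ I) U) where
  simple := by
    rw [isSimpleModule_iff_isCoatom]
    have hf := h.isUniserialModule.finite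
    have := h.isUniserialModule.nontrivial
    -- `J U` is proper by Nakayama. It contains all components at vertices other than `a`, so a
    -- larger submodule has a nonzero component at `a`, hence contains `x`.
    refine ⟨((Ring.jacobson_smul_top_le _ _).trans_lt (Module.jacobson_lt_top _ _)).ne,
      fun N hN => ?_⟩
    obtain ⟨y, hy, hy'⟩ := Set.exists_of_ssubset hN
    have ha : pathClass I (Path.nil : Path a a) • y ≠ 0 := fun h0 => hy' <| by
      refine mem_of_forall_nil_smul I fun c => ?_
      by_cases hc : c = a
      · subst hc; rw [h0]; exact Submodule.zero_mem _
      · exact h.nil_smul_mem_jacobson_smul hV hc y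
    obtain ⟨q, r, -, hq⟩ := h.exists_smul_mem hy ha
    rw [hV.eq_nil q, h.nil_smul] at hq
    exact h.eq_top_of_mem hq
  nil_smul s := by
    obtain ⟨y, rfl⟩ := Submodule.Quotient.mk_surjective _ s
    rw [← Submodule.Quotient.mk_smul, Submodule.Quotient.eq]
    refine mem_of_forall_nil_smul I fun c => ?_
    by_cases hc : c = a
    · subst hc
      rw [smul_sub, nil_smul_pathClass_smul, sub_self]
      exact Submodule.zero_mem _
    · exact h.nil_smul_mem_jacobson_smul hV hc _

end TopSocle

/-! ### Segments of a mast are masts of submodules and quotients -/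

section Submasts

variable {K : Type w} {V : Type u} [Quiver.{v} V] [Field K] [Fintype V]
  {I : Ideal (PathAlgebra K V)} [I.IsTwoSided]
  {U : Type*} [AddCommGroup U] [Module (PathAlgebra K V ⧸ I) U]
  [Module K U] [IsScalarTower K (PathAlgebra K V ⧸ I) U]

/-- With `HasMast.quotient_last`, this realises every segment of a mast on a subquotient, so that
(N) can be applied to segments. -/
theorem HasMast.terminal (hV : IsAcyclicQuiver V) {a b c : V} {q : Path a c} {r : Path c b} {x : U}
    (h : HasMast I (q.comp r) x) : HasMast I r
      (⟨pathClass I q • x, Submodule.mem_span_singleton_self _⟩ :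
        Submodule.span (PathAlgebra K V ⧸ I) {pathClass I q • x}) where
  nil_smul := Subtype.ext (nil_smul_pathClass_smul I q x)
  ne_zero h0 := h.ne_zero <| by
    rw [← pathClass_smul_smul]
    exact congrArg Subtype.val h0
  nil_smul_eq d := by
    rintro ⟨y, hy⟩
    obtain h0 | ⟨q', r', k, hp, h0⟩ := h.nil_smul_eq d y
    · exact Or.inl (Subtype.ext h0)
    obtain ⟨s, rfl⟩ | ⟨s, rfl⟩ := Path.comparable_of_comp_eq_comp q r q' r' hp.symm
    · refine Or.inr ⟨s, r', k, ?_, Subtype.ext ?_⟩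
      · rwa [Path.comp_assoc, Path.comp_inj_right] at hp
      · exact h0.trans (by rw [← pathClass_smul_smul]; rfl)
    · by_cases hs : s.length = 0
      · obtain rfl := Path.eq_of_length_zero s hs
        obtain rfl := Path.eq_nil_of_length_zero s hs
        refine Or.inr ⟨Path.nil, r', k, ?_, Subtype.ext ?_⟩
        · rw [Path.comp_nil, Path.comp_inj_right] at hp
          rw [Path.nil_comp, hp]
        · refine h0.trans ?_
          change _ = k • pathClass I Path.nil • pathClass I (q'.comp Path.nil) • x
          rw [nil_smul_pathClass_smul, Path.comp_nil]
      -- Here `d` lies strictly before `c` on the mast, so the submodule generated by `q x` has no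
      -- component at `d`: returning to `d` would need a cycle.
      · left
        refine Subtype.ext ?_
        change pathClass I (Path.nil : Path d d) • y = 0
        obtain ⟨t, rfl⟩ := Submodule.mem_span_singleton.1 hy
        rw [← pathClass_smul_smul I s, smul_smul, smul_smul, mul_assoc, ← mul_assoc,
          nil_mul_mul_pathClass I hV s hs, zero_smul]

theorem HasMast.quotient_last (hV : IsAcyclicQuiver V) {a b c : V} {q : Path a c} {α : c ⟶ b}
    {x : U} (h : HasMast I (q.cons α) x) : HasMast I q
      (Submodule.Quotient.mk x :
        U ⧸ Submodule.span (PathAlgebra K V ⧸ I) {pathClass I (q.cons α) • x}) where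
  nil_smul := by rw [← Submodule.Quotient.mk_smul, h.nil_smul]
  ne_zero h0 := by
    rw [← Submodule.Quotient.mk_smul, Submodule.Quotient.mk_eq_zero,
      Submodule.mem_span_singleton] at h0
    obtain ⟨r, hr⟩ := h0
    obtain ⟨r, rfl⟩ := Ideal.Quotient.mk_surjective r
    rw [h.smul_last hV] at hr
    have hcb : c ≠ b := by
      rintro rfl
      exact (hV.isEmpty_hom Path.nil).false α
    apply h.ne_zero
    rw [← Path.comp_toPath_eq_cons, ← pathClass_smul_smul, ← nil_smul_pathClass_smul I q, ← hr,
      smul_comm (pathClass I (Path.nil : Path c c)) (_ : K), pathClass_smul_smul_of_ne I _ _ hcb,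
      smul_zero, smul_zero]
  nil_smul_eq d y := by
    obtain ⟨y, rfl⟩ := Submodule.Quotient.mk_surjective _ y
    rw [← Submodule.Quotient.mk_smul]
    obtain h0 | ⟨q', r', k, hp, h0⟩ := h.nil_smul_eq d y
    · rw [h0]; exact Or.inl rfl
    · rw [h0]
      cases r' with
      | nil =>
        obtain rfl : q' = q.cons α := hp
        left
        rw [Submodule.Quotient.mk_eq_zero]
        exact Submodule.smul_of_tower_mem _ _ (Submodule.mem_span_singleton_self _)
      | @cons e _ r' β =>
        right
        simp only [Path.comp_cons] at hp
        obtain rfl := Path.obj_eq_of_cons_eq_cons hp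
        exact ⟨q', r', k, eq_of_heq (Path.heq_of_cons_eq_cons hp), rfl⟩

end Submasts

/-! ### Consequences of condition (N) -/

section ConditionN

variable {K : Type w} {V : Type u} [Quiver.{v} V] [Field K] [Fintype V]
  {I : Ideal (PathAlgebra K V)} [I.IsTwoSided]

theorem HasMast.isMast (hV : IsAcyclicQuiver V) {U : Type (max u v w)} [AddCommGroup U]
    [Module (PathAlgebra K V ⧸ I) U] [Module K U] [IsScalarTower K (PathAlgebra K V ⧸ I) U]
    {a b : V} {p : Path a b} {x : U} (h : HasMast I p x) : IsMast I p :=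
  ⟨ModuleCat.of _ U, h.isUniserialModule, h.length_eq hV, x, h.ne_zero⟩

theorem HasMast.isMast_initial (hV : IsAcyclicQuiver V) {a b c : V} {q : Path a c} {r : Path c b}
    {U : Type (max u v w)} [AddCommGroup U]
    [Module (PathAlgebra K V ⧸ I) U] [Module K U] [IsScalarTower K (PathAlgebra K V ⧸ I) U]
    {x : U} (h : HasMast I (q.comp r) x) : IsMast I q := by
  induction r generalizing U with
  | nil => exact h.isMast hV
  | cons r α ih => exact ih (h.quotient_last hV)

/-- The cycles allowed by (N) are trivial in an acyclic quiver. -/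
theorem ConditionN.eq_toPath (hV : IsAcyclicQuiver V) (hN : ConditionN I) {a b : V} (α : a ⟶ b)
    {p : Path a b} (hp : IsMast I p) : p = α.toPath := by
  have h0 : p.length ≠ 0 := fun h0 => by
    obtain rfl := Path.eq_of_length_zero p h0
    exact (hV.isEmpty_hom Path.nil).false α
  obtain ⟨c, rfl⟩ | ⟨c, rfl⟩ := hN a b α p (Nat.pos_of_ne_zero h0) hp
  · rw [hV.eq_nil c, Path.comp_nil]
  · rw [hV.eq_nil c, Path.nil_comp]

section

variable {U : Type (max u v w)} [AddCommGroup U] [Module (PathAlgebra K V ⧸ I) U] [Module K U]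
  [IsScalarTower K (PathAlgebra K V ⧸ I) U] {a b c : V} {p : Path a b} {x : U}

/-- Under condition (N), only the initial segments of the mast act nontrivially on the top. -/
theorem HasMast.exists_comp_eq (hV : IsAcyclicQuiver V) (hN : ConditionN I) (h : HasMast I p x)
    {q : Path a c} (hq : pathClass I q • x ≠ 0) : ∃ r : Path c b, q.comp r = p := by
  induction q with
  | nil => exact ⟨p, Path.nil_comp p⟩
  | @cons d c q β ih =>
    have e : pathClass I β.toPath • pathClass I q • x = pathClass I (q.cons β) • x :=
      pathClass_smul_smul I _ _ _
    obtain ⟨r, rfl⟩ := ih fun h0 => hq (by rw [← e, h0, smul_zero])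
    obtain h0 | ⟨q', r', k, hp, -⟩ := h.nil_smul_eq c (pathClass I (q.cons β) • x)
    · rw [nil_smul_pathClass_smul] at h0
      exact (hq h0).elim
    -- The vector lands at a vertex of the mast. If that vertex comes after the end of `q`, the
    -- intermediate segment `s` is a mast parallel to `β`, hence equals `β` by (N); if it comes
    -- earlier, `β` closes a cycle.
    obtain ⟨s, rfl⟩ | ⟨s, rfl⟩ := Path.comparable_of_comp_eq_comp q r q' r' hp.symm
    · rw [Path.comp_assoc, Path.comp_inj_right] at hp
      subst hp
      obtain rfl := hN.eq_toPath hV β ((h.terminal hV).isMast_initial hV)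
      exact ⟨r', by rw [← Path.comp_toPath_eq_cons, Path.comp_assoc]⟩
    · exact ((hV.isEmpty_hom s).false β).elim

theorem HasMast.nil_smul_mk_smul (hV : IsAcyclicQuiver V) (hN : ConditionN I) (h : HasMast I p x)
    {q : Path a c} {r : Path c b} (hq : q.comp r = p) (f : PathAlgebra K V) :
    pathClass I (Path.nil : Path c c) • Ideal.Quotient.mk I f • x =
      coeff K q f • pathClass I q • x := by
  induction f using PathAlgebra.induction with
  | zero => simp
  | add f g hf hg => rw [map_add, map_add, add_smul, add_smul, smul_add, hf, hg]
  | @smul k d e s =>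
    rw [mk_smul_eq, map_smul, smul_assoc, smul_assoc, smul_comm]
    congr 1
    change _ • pathClass I s • _ = _
    by_cases he : e = c
    · subst he
      rw [nil_smul_pathClass_smul]
      by_cases hd : d = a
      · subst hd
        by_cases hs : s = q
        · rw [hs, coeff_self, one_smul]
        · rw [coeff_of_ne hs, zero_smul]
          by_contra h0
          obtain ⟨r', hr'⟩ := h.exists_comp_eq hV hN h0
          exact hs (hV.initial_unique (hr'.trans hq.symm))
      · rw [coeff_of_start_ne _ _ hd, zero_smul, pathClass_smul_of_ne I _ h.nil_smul hd]
    · rw [coeff_of_end_ne _ _ he, zero_smul, pathClass_smul_smul_of_ne I _ _ (Ne.symm he)]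

/-- The annihilator of `x` depends on `p` only, since the right-hand side does not mention the
module. -/
theorem HasMast.mk_smul_eq_zero_iff (hV : IsAcyclicQuiver V) (hN : ConditionN I)
    (h : HasMast I p x) (f : PathAlgebra K V) : Ideal.Quotient.mk I f • x = 0 ↔
      ∀ (c : V) (q : Path a c) (r : Path c b), q.comp r = p → coeff K q f = 0 := by
  constructor
  · intro h0 c q r hq
    have := h.nil_smul_mk_smul hV hN hq f
    rw [h0, smul_zero] at this
    refine (smul_eq_zero.1 this.symm).resolve_right fun hz => h.ne_zero ?_
    rw [← hq, ← pathClass_smul_smul, hz, smul_zero]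
  · intro H
    refine eq_zero_of_forall_nil_smul I fun c => ?_
    obtain h0 | ⟨q, r, k, hq, -⟩ := h.nil_smul_eq c (Ideal.Quotient.mk I f • x)
    · exact h0
    · rw [h.nil_smul_mk_smul hV hN hq, H c q r hq, zero_smul]

/-- Under condition (N), a uniserial module is determined by its mast. -/
theorem HasMast.nonempty_linearEquiv (hV : IsAcyclicQuiver V) (hN : ConditionN I)
    (h : HasMast I p x) {U' : Type (max u v w)} [AddCommGroup U']
    [Module (PathAlgebra K V ⧸ I) U'] [Module K U'] [IsScalarTower K (PathAlgebra K V ⧸ I) U']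
    {x' : U'} (h' : HasMast I p x') : Nonempty (U ≃ₗ[PathAlgebra K V ⧸ I] U') := by
  refine nonempty_linearEquiv_of_smul_eq_zero_iff h.span_eq_top h'.span_eq_top fun r => ?_
  obtain ⟨r, rfl⟩ := Ideal.Quotient.mk_surjective r
  rw [h.mk_smul_eq_zero_iff hV hN, h'.mk_smul_eq_zero_iff hV hN]

end

end ConditionN

/-! ### Deforming the action of an arrow -/

section Deformation

variable {K : Type w} {V : Type u} [Quiver.{v} V] [Field K] [Fintype V]
  (I : Ideal (PathAlgebra K V)) [I.IsTwoSided] {a b : V} (α : a ⟶ b)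
  (M : Type*) [AddCommGroup M] [Module (PathAlgebra K V ⧸ I) M] [Module K M]
  [IsScalarTower K (PathAlgebra K V ⧸ I) M]

/-- A linear map that can be added to the action of the arrow `α`. -/
structure Deformation where
  map : M →ₗ[K] M
  mk_smul_map (r : PathAlgebra K V) (y : M) :
    Ideal.Quotient.mk I r • map y = coeff K (Path.nil : Path b b) r • map y
  map_mk_smul (r : PathAlgebra K V) (y : M) :
    map (Ideal.Quotient.mk I r • y) = coeff K (Path.nil : Path a a) r • map y
  map_map (y : M) : map (map y) = 0
  coeff_eq_zero (r : PathAlgebra K V) : r ∈ I → coeff K α.toPath r = 0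

namespace Deformation

variable {I α M} (D : Deformation I α M)

/-- A multiple of a deformation. -/
def smul (k : K) : Deformation I α M where
  map := k • D.map
  mk_smul_map r y := by
    rw [LinearMap.smul_apply, smul_comm, D.mk_smul_map, smul_comm]
  map_mk_smul r y := by
    rw [LinearMap.smul_apply, LinearMap.smul_apply, D.map_mk_smul, smul_comm]
  map_map y := by
    rw [LinearMap.smul_apply, LinearMap.smul_apply, map_smul, D.map_map, smul_zero, smul_zero]
  coeff_eq_zero := D.coeff_eq_zero

/-- The deformed action of the path algebra. -/
def pathAlgebraHom : PathAlgebra K V →+* Module.End K M where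
  toFun r := Algebra.lsmul K K M (Ideal.Quotient.mk I r) + coeff K α.toPath r • D.map
  map_zero' := by simp
  map_one' := by rw [coeff_arrow_one, map_one, map_one, zero_smul, add_zero]
  map_add' r s := by
    rw [map_add, map_add, map_add, add_smul]
    abel
  map_mul' r s := by
    ext y
    -- The quadratic term vanishes by `map_map`, and the two mixed terms add up to the derivation
    -- rule `coeff_arrow_mul`.
    simp only [Module.End.mul_apply, LinearMap.add_apply, LinearMap.smul_apply,
      Algebra.lsmul_coe, coeff_arrow_mul, map_mul, mul_smul, map_add, map_smul,
      D.map_map, D.map_mk_smul, smul_zero, add_zero, add_smul]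
    rw [D.mk_smul_map, smul_comm (coeff K α.toPath s), add_assoc, add_comm (coeff K _ r • _)]

/-- The deformed action of the quotient algebra. -/
def ringHom : PathAlgebra K V ⧸ I →+* Module.End K M :=
  Ideal.Quotient.lift I D.pathAlgebraHom fun r hr => by
    change Algebra.lsmul K K M (Ideal.Quotient.mk I r) + coeff K α.toPath r • D.map = 0
    rw [Ideal.Quotient.eq_zero_iff_mem.2 hr, D.coeff_eq_zero r hr, map_zero, zero_smul, add_zero]

/-- The deformed module. -/
def Carrier (_ : Deformation I α M) : Type _ := M

instance : AddCommGroup D.Carrier := inferInstanceAs (AddCommGroup M)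

instance : Module K D.Carrier := inferInstanceAs (Module K M)

instance : Module (PathAlgebra K V ⧸ I) D.Carrier :=
  Module.compHom M D.ringHom

/-- The identity map to the deformed module. -/
def equiv : M ≃ₗ[K] D.Carrier := LinearEquiv.refl K M

theorem mk_smul_equiv (r : PathAlgebra K V) (y : M) : Ideal.Quotient.mk I r • D.equiv y =
    D.equiv (Ideal.Quotient.mk I r • y + coeff K α.toPath r • D.map y) := rfl

instance : IsScalarTower K (PathAlgebra K V ⧸ I) D.Carrier :=
  IsScalarTower.of_algebraMap_smul fun k y => by
    obtain ⟨y, rfl⟩ := D.equiv.surjective y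
    have : algebraMap K (PathAlgebra K V ⧸ I) k = Ideal.Quotient.mk I (k • 1) := by
      rw [mk_smul_eq, map_one, Algebra.algebraMap_eq_smul_one]
    rw [this, mk_smul_equiv, (coeff K α.toPath).map_smul, coeff_arrow_one, smul_zero, zero_smul,
      add_zero, mk_smul_eq, map_one, smul_assoc, one_smul, map_smul]

theorem nil_smul_equiv (c : V) (y : M) : pathClass I (Path.nil : Path c c) • D.equiv y =
    D.equiv (pathClass I (Path.nil : Path c c) • y) := by
  rw [pathClass, mk_smul_equiv, coeff_of_length_ne _ _ (by simp), zero_smul, add_zero]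

theorem arrow_smul_equiv (y : M) : pathClass I α.toPath • D.equiv y =
    D.equiv (pathClass I α.toPath • y + D.map y) := by
  rw [pathClass, mk_smul_equiv, coeff_self, one_smul]

/-- The deformation changes the action of no path but `α`. An initial segment equal to `α` would
already end at `b`, and then `r` would be trivial. -/
theorem pathClass_smul_equiv_of_ne {c : V} {q : Path a c} {r : Path c b} (hV : IsAcyclicQuiver V)
    (h : q.comp r ≠ α.toPath) (y : M) : pathClass I q • D.equiv y =
      D.equiv (pathClass I q • y) := by
  rw [pathClass, mk_smul_equiv]
  by_cases hc : c = b
  · subst hc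
    rw [hV.eq_nil r, Path.comp_nil] at h
    rw [coeff_of_ne h, zero_smul, add_zero]
  · rw [coeff_of_end_ne _ _ hc, zero_smul, add_zero]

theorem hasMast (hV : IsAcyclicQuiver V) {p : Path a b} {x : M} (h : HasMast I p x)
    (hp : p ≠ α.toPath) : HasMast I p (D.equiv x) where
  nil_smul := by rw [nil_smul_equiv, h.nil_smul]
  ne_zero := by
    rw [D.pathClass_smul_equiv_of_ne (r := Path.nil) hV hp]
    exact fun h0 => h.ne_zero (D.equiv.map_eq_zero_iff.1 h0)
  nil_smul_eq c y := by
    obtain ⟨y, rfl⟩ := D.equiv.surjective y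
    rw [nil_smul_equiv]
    obtain h0 | ⟨q, r, k, rfl, h0⟩ := h.nil_smul_eq c y
    · rw [h0, map_zero]; exact Or.inl rfl
    · exact Or.inr ⟨q, r, k, rfl, by rw [h0, map_smul, D.pathClass_smul_equiv_of_ne hV hp]⟩

/-- The deformation of a module with a mast which changes `α x` by the last element. -/
theorem exists_of_hasMast (hV : IsAcyclicQuiver V) (hI : ∀ x ∈ I, x ∈ arrowIdealPow K V 2)
    (α : a ⟶ b) {p : Path a b} {x : M} (h : HasMast I p x) :
    ∃ D : Deformation I α M, D.map x = pathClass I p • x := by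
  have hx : x ≠ 0 := fun e => h.ne_zero (by rw [e, smul_zero])
  obtain ⟨f, hf⟩ := (LinearMap.toSpanSingleton K M x).exists_leftInverse_of_injective
    (LinearMap.ker_toSpanSingleton K hx)
  have hfx : f x = 1 := by simpa using LinearMap.congr_fun hf 1
  have hab : a ≠ b := by
    rintro rfl
    exact (hV.isEmpty_hom Path.nil).false α
  -- Project to the component at `a`, read off the coefficient of `x` by `f`, and multiply `p x` by
  -- it. Since `a ≠ b`, the square of `E` is zero.
  let E : M →ₗ[K] M := (LinearMap.toSpanSingleton K M (pathClass I p • x)) ∘ₗ f ∘ₗ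
    (Algebra.lsmul K K M (pathClass I (Path.nil : Path a a)))
  have hE (y : M) : E y = f (pathClass I (Path.nil : Path a a) • y) • pathClass I p • x := rfl
  refine ⟨⟨E, fun r y => ?_, fun r y => ?_, fun y => ?_, fun r hr => ?_⟩, ?_⟩
  · rw [hE, smul_comm, h.smul_last hV, smul_comm]
  · rw [hE, hE, h.nil_smul_smul hV, map_smul, smul_assoc]
  · rw [hE y, map_smul, hE, pathClass_smul_smul_of_ne I _ _ hab, map_zero, zero_smul, smul_zero]
  · exact coeff_eq_zero_of_mem (hI r hr) _ (by simp)
  · change E x = _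
    rw [hE, h.nil_smul, hfx, one_smul]

end Deformation

/-- The component at `a` is the line through the generator, so an isomorphism sends `x` to a nonzero
multiple of `x'`. Rescaling the generator does not affect the ratio of `α x` to `p x`. -/
theorem HasMast.arrow_smul_unique {I : Ideal (PathAlgebra K V)} [I.IsTwoSided]
    {U U' : Type*} [AddCommGroup U] [Module (PathAlgebra K V ⧸ I) U]
    [Module K U] [IsScalarTower K (PathAlgebra K V ⧸ I) U] [AddCommGroup U']
    [Module (PathAlgebra K V ⧸ I) U'] [Module K U'] [IsScalarTower K (PathAlgebra K V ⧸ I) U']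
    (hV : IsAcyclicQuiver V) {a b : V} {α : a ⟶ b} {p : Path a b} {x : U} {x' : U'}
    (h : HasMast I p x) (h' : HasMast I p x') (e : U ≃ₗ[PathAlgebra K V ⧸ I] U') {l l' : K}
    (hl : pathClass I α.toPath • x = l • pathClass I p • x)
    (hl' : pathClass I α.toPath • x' = l' • pathClass I p • x') : l = l' := by
  have hx : x ≠ 0 := fun e => h.ne_zero (by rw [e, smul_zero])
  have he (k : K) (y : U) : e (k • y) = k • e y := by
    rw [← algebraMap_smul (PathAlgebra K V ⧸ I) k y, map_smul, algebraMap_smul]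
  have hex : pathClass I (Path.nil : Path a a) • e x = e x := by rw [← map_smul, h.nil_smul]
  obtain h0 | ⟨q, r, t, -, h0⟩ := h'.nil_smul_eq a (e x)
  · rw [hex] at h0
    exact (hx (e.map_eq_zero_iff.1 h0)).elim
  rw [hex, hV.eq_nil q, h'.nil_smul] at h0
  have ht : t ≠ 0 := by
    rintro rfl
    rw [zero_smul] at h0
    exact hx (e.map_eq_zero_iff.1 h0)
  have := congrArg e hl
  rw [map_smul, he, map_smul, h0, smul_comm, hl', smul_comm _ t, smul_comm l t] at this
  exact (smul_left_injective K h'.ne_zero ((smul_right_injective U' ht) this)).symm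

/-- If an arrow has a mast different from it with the same end points, then there are pairwise
non-isomorphic modules with this mast, indexed by the ground field. -/
theorem HasMast.exists_family {I : Ideal (PathAlgebra K V)} [I.IsTwoSided]
    {U : Type (max u v w)} [AddCommGroup U] [Module (PathAlgebra K V ⧸ I) U]
    [Module K U] [IsScalarTower K (PathAlgebra K V ⧸ I) U]
    (hV : IsAcyclicQuiver V) (hI : ∀ x ∈ I, x ∈ arrowIdealPow K V 2)
    {a b : V} {α : a ⟶ b} {p : Path a b} {x : U} (h : HasMast I p x) (hp : p ≠ α.toPath) :
    ∃ D : K → Deformation I α U, (∀ k, HasMast I p ((D k).equiv x)) ∧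
      ∀ k k', Nonempty ((D k).Carrier ≃ₗ[PathAlgebra K V ⧸ I] (D k').Carrier) → k = k' := by
  obtain ⟨D, hD⟩ := Deformation.exists_of_hasMast hV hI α h
  refine ⟨D.smul, fun k => (D.smul k).hasMast hV h hp, ?_⟩
  rintro k k' ⟨e⟩
  obtain ⟨l, hl⟩ : ∃ l : K, pathClass I α.toPath • x = l • pathClass I p • x := by
    obtain h0 | ⟨q, r, l, hq, h0⟩ := h.nil_smul_eq b (pathClass I α.toPath • x)
    · rw [nil_smul_pathClass_smul] at h0
      exact ⟨0, by rw [h0, zero_smul]⟩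
    · rw [nil_smul_pathClass_smul] at h0
      rw [hV.eq_nil r, Path.comp_nil] at hq
      exact ⟨l, hq ▸ h0⟩
  have key (k : K) : pathClass I α.toPath • (D.smul k).equiv x =
      (l + k) • pathClass I p • (D.smul k).equiv x := by
    rw [Deformation.arrow_smul_equiv,
      (D.smul k).pathClass_smul_equiv_of_ne (r := Path.nil) hV hp, ← map_smul, hl]
    change (D.smul k).equiv (_ + k • D.map x) = _
    rw [hD, add_smul]
  exact add_left_cancel (((D.smul k).hasMast hV h hp).arrow_smul_unique hV
    ((D.smul k').hasMast hV h hp) e (key k) (key k'))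

end Deformation

/-! ### Extensions of simple modules -/

section Ext

open CategoryTheory

variable {R : Type u} [Ring R] {A B C : Type u} [AddCommGroup A] [Module R A] [AddCommGroup B]
  [Module R B] [AddCommGroup C] [Module R C]

/-- In the long exact sequence for `Hom(C, -)`, the obstruction to lifting the identity of `C` lies
in `Ext¹(C, A)`. -/
theorem exists_rightInverse_of_not_extOneNonzero {i : A →ₗ[R] B} {g : B →ₗ[R] C}
    (hi : Function.Injective i) (hg : Function.Surjective g) (hig : Function.Exact i g)
    (h : ¬ ExtOneNonzero R C A) : ∃ s : C →ₗ[R] B, g ∘ₗ s = LinearMap.id := by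
  let T : ShortComplex (ModuleCat.{u} R) :=
    .mk (ModuleCat.ofHom i) (ModuleCat.ofHom g) (by
      ext x
      exact hig.apply_apply_eq_zero x)
  have hT : T.ShortExact :=
    { exact := (ShortComplex.ShortExact.moduleCat_exact_iff_function_exact T).2 hig
      mono_f := (ModuleCat.mono_iff_injective _).2 hi
      epi_g := (ModuleCat.epi_iff_surjective _).2 hg }
  have : Subsingleton (Abelian.Ext (ModuleCat.of R C) (ModuleCat.of R A) 1) :=
    not_nontrivial_iff_subsingleton.1 h
  obtain ⟨σ, hσ⟩ := Abelian.Ext.covariant_sequence_exact₃ (X := ModuleCat.of R C) hT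
    (Abelian.Ext.mk₀ (𝟙 _)) (zero_add 1) (Subsingleton.elim _ _)
  obtain ⟨σ, rfl⟩ := Abelian.Ext.homEquiv₀.symm.surjective σ
  refine ⟨σ.hom, ?_⟩
  rw [Abelian.Ext.homEquiv₀_symm_apply, Abelian.Ext.mk₀_comp_mk₀] at hσ
  exact congrArg ModuleCat.Hom.hom (Abelian.Ext.homEquiv₀.symm.injective hσ)

/-- Since `B` is projective, every class in `Ext¹(C, A)` is the pushout of the class of `B → C`
along a map from the kernel. It vanishes once that map extends to `B`. -/
theorem not_extOneNonzero_of_forall_exists [Module.Projective R B] {g : B →ₗ[R] C}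
    (hg : Function.Surjective g)
    (h : ∀ f : LinearMap.ker g →ₗ[R] A, ∃ f' : B →ₗ[R] A, ∀ y, f' y.1 = f y) :
    ¬ ExtOneNonzero R C A := by
  rw [ExtOneNonzero, not_nontrivial_iff_subsingleton]
  have hT := LinearMap.shortExact_shortComplexKer hg
  have : Projective g.shortComplexKer.X₂ :=
    ModuleCat.projective_of_categoryTheory_projective (ModuleCat.of R B)
  refine subsingleton_of_forall_eq 0 fun x => ?_
  obtain ⟨f, rfl⟩ := precomp_extClass_surjective_of_projective_X₂ (ModuleCat.of R A) hT 0 x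
  obtain ⟨f, rfl⟩ := Abelian.Ext.homEquiv₀.symm.surjective f
  obtain ⟨f', hf⟩ := h f.hom
  have e : f = g.shortComplexKer.f ≫ ModuleCat.ofHom f' := by
    ext y
    exact (hf y).symm
  change hT.extClass.comp (Abelian.Ext.mk₀ f) (add_comm 1 0) = 0
  rw [e, ← Abelian.Ext.mk₀_comp_mk₀]
  exact hT.extClass_comp_assoc _

end Ext

/-! ### Nonzero extensions of simples correspond to arrows -/

section ExtSimple

variable {K : Type w} {V : Type u} [Quiver.{v} V] [Field K] [Fintype V]
  {I : Ideal (PathAlgebra K V)} [I.IsTwoSided] {a b : V}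
  {S S' : Type (max u v w)} [AddCommGroup S] [Module (PathAlgebra K V ⧸ I) S]
  [AddCommGroup S'] [Module (PathAlgebra K V ⧸ I) S']

/-- Present `S` as the quotient of the algebra by the annihilator `m` of a vector. With no arrow
from `a` to `b`, a map `f` from `m` to `S'` kills every arrow starting at `a`, hence every `r e_a`
with `r ∈ m`. So `f r = r f(1 - e_a)`, which extends to the whole algebra. -/
theorem nonempty_hom_of_extOneNonzero (hV : IsAcyclicQuiver V) (hS : IsVertexSimple I a S)
    (hS' : IsVertexSimple I b S') (h : ExtOneNonzero (PathAlgebra K V ⧸ I) S S') :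
    Nonempty (a ⟶ b) := by
  by_contra hab
  have := hS.simple
  have := IsSimpleModule.nontrivial (PathAlgebra K V ⧸ I) S
  obtain ⟨s, hs⟩ := exists_ne (0 : S)
  have hsurj := IsSimpleModule.toSpanSingleton_surjective (PathAlgebra K V ⧸ I) hs
  refine not_extOneNonzero_of_forall_exists hsurj (fun f => ?_) h
  let m := LinearMap.ker (LinearMap.toSpanSingleton (PathAlgebra K V ⧸ I) S s)
  have mem_m (r : PathAlgebra K V ⧸ I) : r ∈ m ↔ r • s = 0 := by
    simp [m]
  let Z : Submodule (PathAlgebra K V ⧸ I) (PathAlgebra K V ⧸ I) := (LinearMap.ker f).map m.subtype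
  have hZ (r : PathAlgebra K V ⧸ I) (hr : r ∈ Z) (hm : r ∈ m) : f ⟨r, hm⟩ = 0 := by
    obtain ⟨y, hy, rfl⟩ := hr
    exact hy
  have arrow_mem (c : V) (β : a ⟶ c) : pathClass I β.toPath ∈ Z := by
    have hm : pathClass I β.toPath ∈ m := by
      rw [mem_m]
      exact pathClass_smul_eq_zero_of_simple hV _ (by simp) s
    refine ⟨⟨_, hm⟩, ?_, rfl⟩
    have hcb : b ≠ c := by
      rintro rfl
      exact hab ⟨β⟩
    rw [SetLike.mem_coe, LinearMap.mem_ker, ← hS'.nil_smul (f _), ← map_smul]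
    have : pathClass I (Path.nil : Path b b) • (⟨_, hm⟩ : m) = 0 :=
      Subtype.ext (pathClass_mul_of_ne I _ _ hcb)
    rw [this, map_zero]
  -- Paths of positive length starting at `a` are left multiples of arrows starting at `a`, so
  -- modulo `Z` only the trivial path remains.
  have key (r : PathAlgebra K V) : Ideal.Quotient.mk I r * pathClass I (Path.nil : Path a a) -
      coeff K (Path.nil : Path a a) r • pathClass I (Path.nil : Path a a) ∈ Z := by
    induction r using PathAlgebra.induction with
    | zero => simp
    | add r s hr hs =>
      rw [map_add, map_add, add_mul, add_smul, add_sub_add_comm]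
      exact Z.add_mem hr hs
    | @smul k c d q =>
      rw [mk_smul_eq, map_smul, smul_mul_assoc, smul_assoc, ← smul_sub]
      refine Submodule.smul_of_tower_mem _ _ ?_
      change pathClass I q * _ - _ ∈ _
      by_cases hc : c = a
      · subst hc
        rw [pathClass_mul, Path.nil_comp]
        by_cases hq : q.length = 0
        · obtain rfl := Path.eq_of_length_zero q hq
          rw [Path.eq_nil_of_length_zero q hq, coeff_self, one_smul, sub_self]
          exact Z.zero_mem
        · rw [coeff_of_length_ne _ _ (by simpa using hq), zero_smul, sub_zero]
          obtain ⟨e, β, q, rfl, -⟩ := (Path.length_ne_zero_iff_eq_comp q).1 hq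
          rw [← pathClass_mul]
          exact Z.smul_mem _ (arrow_mem e β)
      · rw [pathClass_mul_of_ne I _ _ hc, coeff_of_start_ne _ _ hc, zero_smul, sub_zero]
        exact Z.zero_mem
  have hone : 1 - pathClass I (Path.nil : Path a a) ∈ m := by
    rw [mem_m, sub_smul, one_smul, hS.nil_smul, sub_self]
  refine ⟨LinearMap.toSpanSingleton _ _ (f ⟨_, hone⟩), ?_⟩
  rintro ⟨r, hr⟩
  rw [LinearMap.toSpanSingleton_apply, ← map_smul, ← sub_eq_zero, ← map_sub]
  have hr' : r * pathClass I (Path.nil : Path a a) ∈ Z := by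
    have hr' := (mem_m r).1 hr
    obtain ⟨r, rfl⟩ := Ideal.Quotient.mk_surjective r
    let _ : Module K S := Module.compHom S (algebraMap K (PathAlgebra K V ⧸ I))
    have : IsScalarTower K (PathAlgebra K V ⧸ I) S :=
      IsScalarTower.of_algebraMap_smul fun _ _ => rfl
    rw [hS.mk_smul hV, smul_eq_zero_iff_left hs] at hr'
    have := key r
    rwa [hr', zero_smul, sub_zero] at this
  refine hZ _ ?_ _
  change r * (1 - pathClass I Path.nil) - r ∈ Z
  rw [mul_sub, mul_one, sub_sub_cancel_left]
  exact Z.neg_mem hr'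

variable [Module K S] [IsScalarTower K (PathAlgebra K V ⧸ I) S] [Module K S']
  [IsScalarTower K (PathAlgebra K V ⧸ I) S']

/-- The deformation of `S × S'` for simple modules at the ends of an arrow. -/
theorem exists_deformation_prod (hV : IsAcyclicQuiver V)
    (hI : ∀ x ∈ I, x ∈ arrowIdealPow K V 2) (α : a ⟶ b) (hS : IsVertexSimple I a S)
    (hS' : IsVertexSimple I b S') : ∃ (D : Deformation I α (S × S')) (s : S) (s' : S'),
      s' ≠ 0 ∧ (∀ t, ∃ k : K, t = k • s) ∧ (∀ t, ∃ k : K, t = k • s') ∧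
      (∀ y : S × S', (D.map y).1 = 0) ∧ (∀ y : S × S', y.1 = 0 → D.map y = 0) ∧
      ∀ t, D.map (s, t) = (0, s') := by
  have := hS.simple
  have := hS'.simple
  have := IsSimpleModule.nontrivial (PathAlgebra K V ⧸ I) S
  have := IsSimpleModule.nontrivial (PathAlgebra K V ⧸ I) S'
  obtain ⟨s, hs⟩ := exists_ne (0 : S)
  obtain ⟨s', hs'⟩ := exists_ne (0 : S')
  obtain ⟨f, hf⟩ := (LinearMap.toSpanSingleton K S s).exists_leftInverse_of_injective
    (LinearMap.ker_toSpanSingleton K hs)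
  have hfs : f s = 1 := by simpa using LinearMap.congr_fun hf 1
  let E : S × S' →ₗ[K] S × S' := LinearMap.inr K S S' ∘ₗ LinearMap.toSpanSingleton K S' s' ∘ₗ f ∘ₗ
    LinearMap.fst K S S'
  have hE (y : S × S') : E y = (0, f y.1 • s') := rfl
  refine ⟨⟨E, fun r y => ?_, fun r y => ?_, fun y => ?_, fun r hr => ?_⟩, s, s', hs', fun t => ?_,
    fun t => ?_, fun y => rfl, fun y hy => ?_, fun t => ?_⟩
  · rw [hE, Prod.smul_mk, Prod.smul_mk, hS'.mk_smul hV, smul_zero, smul_zero]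
  · rw [hE, hE, Prod.smul_fst, hS.mk_smul hV, map_smul, Prod.smul_mk, smul_zero, smul_assoc]
  · rw [hE y, hE, map_zero, zero_smul]; rfl
  · exact coeff_eq_zero_of_mem (hI r hr) _ (by simp)
  · obtain ⟨k, hk⟩ := exists_smul_eq_of_simple hV hs (hS.nil_smul s) t
    exact ⟨k, hk.symm⟩
  · obtain ⟨k, hk⟩ := exists_smul_eq_of_simple hV hs' (hS'.nil_smul s') t
    exact ⟨k, hk.symm⟩
  · change E y = 0
    rw [hE, hy, map_zero, zero_smul]; rfl
  · change E (s, t) = _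
    rw [hE, hfs, one_smul]

theorem exists_hasMast_arrow (hV : IsAcyclicQuiver V)
    (hI : ∀ x ∈ I, x ∈ arrowIdealPow K V 2) (α : a ⟶ b) (hS : IsVertexSimple I a S)
    (hS' : IsVertexSimple I b S') : ∃ (D : Deformation I α (S × S')) (x : D.Carrier),
      HasMast I α.toPath x := by
  obtain ⟨D, s, s', hs', hs, hss, -, -, hD⟩ := exists_deformation_prod hV hI α hS hS'
  have := hS.simple
  have := hS'.simple
  have hx : pathClass I α.toPath • D.equiv (s, (0 : S')) = D.equiv ((0 : S), s') := by
    rw [D.arrow_smul_equiv, hD, Prod.smul_mk, pathClass_smul_eq_zero_of_simple hV _ (by simp),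
      smul_zero, Prod.mk_add_mk, zero_add, zero_add]
  have hnil {c d : V} {T : Type (max u v w)} [AddCommGroup T] [Module (PathAlgebra K V ⧸ I) T]
      (hT : IsVertexSimple I c T) (t : T) (hdc : d ≠ c) :
      pathClass I (Path.nil : Path d d) • t = 0 :=
    pathClass_smul_of_ne I _ (hT.nil_smul t) hdc
  have hab : a ≠ b := by
    rintro rfl
    exact (hV.isEmpty_hom Path.nil).false α
  refine ⟨D, D.equiv (s, 0), ?_, ?_, fun c y => ?_⟩
  · rw [D.nil_smul_equiv, Prod.smul_mk, hS.nil_smul, smul_zero]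
  · rw [hx]
    exact fun h0 => hs' (congrArg Prod.snd (D.equiv.map_eq_zero_iff.1 h0))
  · obtain ⟨⟨t, t'⟩, rfl⟩ := D.equiv.surjective y
    rw [D.nil_smul_equiv, Prod.smul_mk]
    by_cases hca : c = a
    · subst hca
      right
      obtain ⟨k, rfl⟩ := hs t
      refine ⟨Path.nil, α.toPath, k, Path.nil_comp _, ?_⟩
      rw [D.nil_smul_equiv, hS.nil_smul, hnil hS' _ hab, Prod.smul_mk, hS.nil_smul, smul_zero,
        ← map_smul, Prod.smul_mk, smul_zero]
    · by_cases hcb : c = b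
      · subst hcb
        right
        obtain ⟨k, rfl⟩ := hss t'
        refine ⟨α.toPath, Path.nil, k, Path.comp_nil _, ?_⟩
        rw [hx, hS'.nil_smul, hnil hS _ hca, ← map_smul, Prod.smul_mk, smul_zero]
      · left
        rw [hnil hS _ hca, hnil hS' _ hcb]
        exact map_zero D.equiv

/-- The deformed `S × S'` is a nonsplit extension: a section would carry `s`, which `α` kills, to a
vector with first component `s`, which `α` sends to `(0, s')`. -/
theorem extOneNonzero_of_hom (hV : IsAcyclicQuiver V)
    (hI : ∀ x ∈ I, x ∈ arrowIdealPow K V 2) (α : a ⟶ b) (hS : IsVertexSimple I a S)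
    (hS' : IsVertexSimple I b S') : ExtOneNonzero (PathAlgebra K V ⧸ I) S S' := by
  obtain ⟨D, s, s', hs', hs, hss, hD₁, hD₂, hD⟩ := exists_deformation_prod hV hI α hS hS'
  have := hS.simple
  have := hS'.simple
  by_contra h
  let i : S' →ₗ[PathAlgebra K V ⧸ I] D.Carrier :=
    { toFun t := D.equiv (0, t)
      map_add' t t' := by rw [← map_add, Prod.mk_add_mk, add_zero]
      map_smul' r t := by
        obtain ⟨r, rfl⟩ := Ideal.Quotient.mk_surjective r
        rw [RingHom.id_apply, D.mk_smul_equiv, hD₂ _ rfl, smul_zero, add_zero, Prod.smul_mk,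
          smul_zero] }
  let g : D.Carrier →ₗ[PathAlgebra K V ⧸ I] S :=
    { toFun y := (D.equiv.symm y).1
      map_add' t t' := by rw [map_add, Prod.fst_add]
      map_smul' r t := by
        obtain ⟨r, rfl⟩ := Ideal.Quotient.mk_surjective r
        obtain ⟨t, rfl⟩ := D.equiv.surjective t
        rw [RingHom.id_apply, D.mk_smul_equiv, D.equiv.symm_apply_apply, D.equiv.symm_apply_apply,
          Prod.fst_add, Prod.smul_fst, Prod.smul_fst, hD₁, smul_zero, add_zero] }
  obtain ⟨σ, hσ⟩ := exists_rightInverse_of_not_extOneNonzero (i := i) (g := g)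
    (fun t t' htt => congrArg Prod.snd (D.equiv.injective htt))
    (fun t => ⟨D.equiv (t, 0), by simp [g]⟩)
    (fun y => by
      obtain ⟨⟨t, t'⟩, rfl⟩ := D.equiv.surjective y
      constructor
      · intro h0
        have h0 : t = 0 := h0
        exact ⟨t', by rw [h0]; rfl⟩
      · rintro ⟨t'', h0⟩
        exact (congrArg Prod.fst (D.equiv.injective h0)).symm) h
  have h1 : g (σ s) = s := LinearMap.congr_fun hσ s
  have h2 : pathClass I α.toPath • σ s = 0 := by
    rw [← map_smul, pathClass_smul_eq_zero_of_simple hV _ (by simp), map_zero]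
  obtain ⟨⟨t, t'⟩, ht⟩ := D.equiv.surjective (σ s)
  rw [← ht] at h1 h2
  have h1 : t = s := h1
  rw [h1, D.arrow_smul_equiv, hD, Prod.smul_mk, pathClass_smul_eq_zero_of_simple hV _ (by simp),
    pathClass_smul_eq_zero_of_simple hV _ (by simp), Prod.mk_add_mk, zero_add, zero_add] at h2
  exact hs' (congrArg Prod.snd (D.equiv.map_eq_zero_iff.1 h2))

end ExtSimple

/-! ### Finite uniserial type -/

section Main

variable {K : Type w} {V : Type u} [Quiver.{v} V] [Field K] [Fintype V]
  {I : Ideal (PathAlgebra K V)} [I.IsTwoSided]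

theorem HasMast.isUniserialWith (hV : IsAcyclicQuiver V) {U S S' : Type (max u v w)}
    [AddCommGroup U] [Module (PathAlgebra K V ⧸ I) U] [Module K U]
    [IsScalarTower K (PathAlgebra K V ⧸ I) U] [AddCommGroup S] [Module (PathAlgebra K V ⧸ I) S]
    [AddCommGroup S'] [Module (PathAlgebra K V ⧸ I) S'] {a b : V} {p : Path a b} {x : U}
    (h : HasMast I p x) (hS : IsVertexSimple I a S) (hS' : IsVertexSimple I b S') :
    IsUniserialWith (PathAlgebra K V ⧸ I) U S S' :=
  ⟨h.isUniserialModule, (h.isVertexSimple_moduleSocle hV).nonempty_linearEquiv hV hS',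
    (h.isVertexSimple_moduleTop hV).nonempty_linearEquiv hV hS⟩

variable [∀ a b : V, Finite (a ⟶ b)]

theorem IsMast.exists_hasMast (hV : IsAcyclicQuiver V) (hI : IsAdmissible I) {a b : V}
    {p : Path a b} (h : IsMast I p) : ∃ (U : Type (max u v w)) (_ : AddCommGroup U)
      (_ : Module (PathAlgebra K V ⧸ I) U) (_ : Module K U)
      (_ : IsScalarTower K (PathAlgebra K V ⧸ I) U) (x : U), HasMast I p x := by
  obtain ⟨U, hU, hl, y, hy⟩ := h
  let _ : Module K U := Module.compHom U (algebraMap K (PathAlgebra K V ⧸ I))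
  have : IsScalarTower K (PathAlgebra K V ⧸ I) U := IsScalarTower.of_algebraMap_smul fun _ _ => rfl
  obtain ⟨m, hm⟩ := hI.1
  obtain ⟨x, hx⟩ := hU.exists_hasMast_of_length_eq I hV hm hl hy
  exact ⟨U, _, _, _, this, x, hx⟩

/-- If condition (N) fails, there is a family of pairwise non-isomorphic modules having the same
mast, which is parallel to an arrow. -/
theorem exists_family_of_not_conditionN (hV : IsAcyclicQuiver V) (hI : IsAdmissible I)
    (hN : ¬ ConditionN I) : ∃ (a b : V) (_ : a ⟶ b) (p : Path a b)
      (F : K → Type (max u v w)) (_ : ∀ k, AddCommGroup (F k))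
      (_ : ∀ k, Module (PathAlgebra K V ⧸ I) (F k)) (_ : ∀ k, Module K (F k))
      (_ : ∀ k, IsScalarTower K (PathAlgebra K V ⧸ I) (F k)) (x : ∀ k, F k),
      (∀ k, HasMast I p (x k)) ∧
        ∀ k k', Nonempty (F k ≃ₗ[PathAlgebra K V ⧸ I] F k') → k = k' := by
  unfold ConditionN at hN
  push Not at hN
  obtain ⟨a, b, α, p, -, hM, hp, -⟩ := hN
  obtain ⟨U, _, _, _, _, x, h⟩ := hM.exists_hasMast hV hI
  -- The trivial cycle in the first alternative of (N) gives `p ≠ α`.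
  obtain ⟨D, hD, hne⟩ := h.exists_family hV hI.2 (α := α) fun e => hp Path.nil e
  exact ⟨a, b, α, p, fun k => (D k).Carrier, inferInstance, inferInstance, inferInstance,
    inferInstance, fun k => (D k).equiv x, hD, hne⟩

theorem conditionN_of_finiteUniserialType [Infinite K] (hV : IsAcyclicQuiver V)
    (hI : IsAdmissible I) (h : FiniteUniserialType (PathAlgebra K V ⧸ I)) : ConditionN I := by
  by_contra hN
  obtain ⟨a, b, α, p, F, _, _, _, _, x, hx, hne⟩ := exists_family_of_not_conditionN hV hI hN
  obtain ⟨n, G, hG⟩ := h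
  choose i hi using fun k => hG (F k) (hx k).isUniserialModule
  obtain ⟨k, k', hkk, hik⟩ := Finite.exists_ne_map_eq_of_infinite i
  obtain ⟨e⟩ := hi k
  obtain ⟨e'⟩ := hi k'
  rw [← hik] at e'
  exact hkk (hne k k' ⟨e.trans e'.symm⟩)

open Classical in
theorem finiteUniserialType_of_conditionN (hV : IsAcyclicQuiver V) (hI : IsAdmissible I)
    (hN : ConditionN I) : FiniteUniserialType (PathAlgebra K V ⧸ I) := by
  obtain ⟨m, hm⟩ := hI.1
  have := finite_totalPath_length_lt V m
  let T := {t : TotalPath V // t.2.2.length < m}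
  let P (t : T) (U : ModuleCat.{max u v w} (PathAlgebra K V ⧸ I)) : Prop :=
    ∃ (_ : Module K U) (_ : IsScalarTower K (PathAlgebra K V ⧸ I) U) (x : U),
      HasMast I t.1.2.2 x
  let F (t : T) : ModuleCat.{max u v w} (PathAlgebra K V ⧸ I) :=
    -- One representative for each path of length below `m`; the zero module is a dummy for paths
    -- that are not masts.
    if h : ∃ U, P t U then h.choose else ModuleCat.of _ PUnit
  have hF (t : T) (h : ∃ U, P t U) : P t (F t) := by
    simp only [F, dif_pos h]
    exact h.choose_spec
  refine ⟨Nat.card T, fun i => F ((Finite.equivFin T).symm i), fun U _ _ hU => ?_⟩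
  let _ : Module K U := Module.compHom U (algebraMap K (PathAlgebra K V ⧸ I))
  have : IsScalarTower K (PathAlgebra K V ⧸ I) U := IsScalarTower.of_algebraMap_smul fun _ _ => rfl
  obtain ⟨a, b, p, x, hx⟩ := hU.exists_hasMast I hV hm
  have hp : p.length < m := by
    by_contra! hp
    exact hx.ne_zero (by rw [pathClass_eq_zero I hm p hp, zero_smul])
  let t : T := ⟨⟨a, b, p⟩, hp⟩
  obtain ⟨_, _, x', hx'⟩ := hF t ⟨ModuleCat.of _ U, _, this, x, hx⟩
  refine ⟨Finite.equivFin T t, ?_⟩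
  have e : F ((Finite.equivFin T).symm (Finite.equivFin T t)) = F t := by
    rw [Equiv.symm_apply_apply]
  change Nonempty (U ≃ₗ[PathAlgebra K V ⧸ I] F ((Finite.equivFin T).symm (Finite.equivFin T t)))
  rw [e]
  exact hx.nonempty_linearEquiv hV hN hx'

theorem IsUniserialWith.exists_hasMast (hV : IsAcyclicQuiver V) (hI : IsAdmissible I)
    {U S S' : Type (max u v w)} [AddCommGroup U] [Module (PathAlgebra K V ⧸ I) U] [Module K U]
    [IsScalarTower K (PathAlgebra K V ⧸ I) U] [AddCommGroup S] [Module (PathAlgebra K V ⧸ I) S]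
    [AddCommGroup S'] [Module (PathAlgebra K V ⧸ I) S'] {a b : V}
    (h : IsUniserialWith (PathAlgebra K V ⧸ I) U S S') (hS : IsVertexSimple I a S)
    (hS' : IsVertexSimple I b S') : ∃ (p : Path a b) (x : U), HasMast I p x := by
  obtain ⟨hU, ⟨e'⟩, ⟨e⟩⟩ := h
  obtain ⟨m, hm⟩ := hI.1
  obtain ⟨c, d, p, x, hx⟩ := hU.exists_hasMast I hV hm
  obtain rfl := ((hx.isVertexSimple_moduleTop hV).congr e).vertex_unique hS
  obtain rfl := ((hx.isVertexSimple_moduleSocle hV).congr e').vertex_unique hS'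
  exact ⟨p, x, hx⟩

theorem conditionN_of_uniqueUniserialOfExt (hV : IsAcyclicQuiver V)
    (hI : IsAdmissible I) (h : UniqueUniserialOfExt (PathAlgebra K V ⧸ I)) : ConditionN I := by
  by_contra hN
  obtain ⟨a, b, α, p, F, _, _, _, _, x, hx, hne⟩ := exists_family_of_not_conditionN hV hI hN
  have hS := (hx 0).isVertexSimple_moduleTop hV
  have hS' := (hx 0).isVertexSimple_moduleSocle hV
  -- All members of the family share the end points of `p`, hence top and socle, and `α` makes
  -- `Ext¹` nonzero. Two distinct parameters already contradict uniqueness.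
  have := (h _ _ hS.simple hS'.simple (extOneNonzero_of_hom hV hI.2 α hS hS')).2 (F 0) (F 1)
    ((hx 0).isUniserialWith hV hS hS') ((hx 1).isUniserialWith hV hS hS')
  exact zero_ne_one (hne 0 1 this)

/-- Under condition (N), a uniserial module whose top and socle have a nontrivial extension has an
arrow as its mast. -/
theorem IsUniserialWith.exists_hasMast_arrow (hV : IsAcyclicQuiver V) (hI : IsAdmissible I)
    (hN : ConditionN I)
    {U S S' : Type (max u v w)} [AddCommGroup U] [Module (PathAlgebra K V ⧸ I) U] [Module K U]
    [IsScalarTower K (PathAlgebra K V ⧸ I) U] [AddCommGroup S] [Module (PathAlgebra K V ⧸ I) S]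
    [AddCommGroup S'] [Module (PathAlgebra K V ⧸ I) S'] {a b : V} (α : a ⟶ b)
    (h : IsUniserialWith (PathAlgebra K V ⧸ I) U S S') (hS : IsVertexSimple I a S)
    (hS' : IsVertexSimple I b S') : ∃ x : U, HasMast I α.toPath x := by
  obtain ⟨p, x, hx⟩ := h.exists_hasMast hV hI hS hS'
  obtain rfl := hN.eq_toPath hV α (hx.isMast hV)
  exact ⟨x, hx⟩

theorem uniqueUniserialOfExt_of_conditionN (hV : IsAcyclicQuiver V) (hI : IsAdmissible I)
    (hN : ConditionN I) : UniqueUniserialOfExt (PathAlgebra K V ⧸ I) := by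
  intro S S' _ _ _ _ hS hS' hExt
  obtain ⟨a, hS⟩ := exists_isVertexSimple I hV S hS
  obtain ⟨b, hS'⟩ := exists_isVertexSimple I hV S' hS'
  obtain ⟨α⟩ := nonempty_hom_of_extOneNonzero hV hS hS' hExt
  constructor
  · let _ : Module K S := Module.compHom S (algebraMap K (PathAlgebra K V ⧸ I))
    have : IsScalarTower K (PathAlgebra K V ⧸ I) S :=
      IsScalarTower.of_algebraMap_smul fun _ _ => rfl
    let _ : Module K S' := Module.compHom S' (algebraMap K (PathAlgebra K V ⧸ I))
    have : IsScalarTower K (PathAlgebra K V ⧸ I) S' :=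
      IsScalarTower.of_algebraMap_smul fun _ _ => rfl
    obtain ⟨D, x, hx⟩ := _root_.exists_hasMast_arrow hV hI.2 α hS hS'
    exact ⟨ModuleCat.of _ D.Carrier, hx.isUniserialWith hV hS hS'⟩
  · intro U U' _ _ _ _ hU hU'
    let _ : Module K U := Module.compHom U (algebraMap K (PathAlgebra K V ⧸ I))
    have : IsScalarTower K (PathAlgebra K V ⧸ I) U :=
      IsScalarTower.of_algebraMap_smul fun _ _ => rfl
    let _ : Module K U' := Module.compHom U' (algebraMap K (PathAlgebra K V ⧸ I))
    have : IsScalarTower K (PathAlgebra K V ⧸ I) U' :=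
      IsScalarTower.of_algebraMap_smul fun _ _ => rfl
    obtain ⟨x, hx⟩ := hU.exists_hasMast_arrow hV hI hN α hS hS'
    obtain ⟨x', hx'⟩ := hU'.exists_hasMast_arrow hV hI hN α hS hS'
    exact hx.nonempty_linearEquiv hV hN hx'

theorem noLongUniserialOfExt_of_conditionN (hV : IsAcyclicQuiver V) (hI : IsAdmissible I)
    (hN : ConditionN I) : NoLongUniserialOfExt (PathAlgebra K V ⧸ I) := by
  intro S S' _ _ _ _ hS hS' hExt U _ _ hU
  obtain ⟨a, hS⟩ := exists_isVertexSimple I hV S hS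
  obtain ⟨b, hS'⟩ := exists_isVertexSimple I hV S' hS'
  obtain ⟨α⟩ := nonempty_hom_of_extOneNonzero hV hS hS' hExt
  let _ : Module K U := Module.compHom U (algebraMap K (PathAlgebra K V ⧸ I))
  have : IsScalarTower K (PathAlgebra K V ⧸ I) U :=
    IsScalarTower.of_algebraMap_smul fun _ _ => rfl
  obtain ⟨x, hx⟩ := hU.exists_hasMast_arrow hV hI hN α hS hS'
  rw [hx.length_eq hV, Path.length_toPath, Nat.cast_one, one_add_one_eq_two]
  exact lt_irrefl _

end Main

end

theorem corollary3p4 (K : Type w) [Field K] [Infinite K]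
    (V : Type u) [Quiver.{v} V] [Fintype V] [∀ a b : V, Finite (a ⟶ b)]
    (hV : IsAcyclicQuiver V)
    (I : Ideal (PathAlgebra K V)) [I.IsTwoSided] (hI : PathAlgebra.IsAdmissible I) :
    List.TFAE [
      FiniteUniserialType (PathAlgebra K V ⧸ I),
      ConditionN I,
      UniqueUniserialOfExt (PathAlgebra K V ⧸ I)] ∧
    (UniqueUniserialOfExt (PathAlgebra K V ⧸ I) →
      NoLongUniserialOfExt (PathAlgebra K V ⧸ I)) := by
  refine ⟨?_, fun h =>
    noLongUniserialOfExt_of_conditionN hV hI (conditionN_of_uniqueUniserialOfExt hV hI h)⟩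
  tfae_have 1 → 2 := conditionN_of_finiteUniserialType hV hI
  tfae_have 2 → 1 := finiteUniserialType_of_conditionN hV hI
  tfae_have 2 → 3 := uniqueUniserialOfExt_of_conditionN hV hI
  tfae_have 3 → 2 := conditionN_of_uniqueUniserialOfExt hV hI
  tfae_finish
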